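/- **Setting.** Let $G=(A\cup B,E)$ be a finite bipartite graph (agents $A$, jobs $B$) in which every vertex ranks its neighbours strictly and every agent has at least one neighbour. Augment $G$ with self-loops, $E'=E\cup\{(u,u):u\in A\cup B\}$, each vertex being last in its own list; a matching is viewed as a perfect matching of the augmented graph, $N(u)$ denoting the partner of $u$. A matching $M$ is *popular* if for every matching $N$ at least as many vertices prefer $M$ to $N$ as prefer $N$ to $M$; it is *$A$-popular* if the same holds when only vertices of $A$ are counted; it is *fully popular* if it is both. For $(a,b)\in E$ let $\mathsf{wt}_N(a,b)$ be $2$ if $a$ and $b$ both prefer each other to their partners in $N$, $-2$ if both prefer their partners in $N$ to each other, and $0$ otherwise; let $\mathsf{wt}_N(u,u)$ be $0$ if $N(u)=u$ and $-1$ otherwise. A *witness* of $N$ is a vector $\alpha\in\{0,\pm1\}^{A\cup B}$ with $\sum_u\alpha_u=0$, $\alpha_a+\alpha_b\ge \mathsf{wt}_N(a,b)$ for all $(a,b)\in E$, and $\alpha_u\ge\mathsf{wt}_N(u,u)$ for all $u$. *Legal edges.* Let $f(a)$ be $a$'s top choice neighbour and $s(a)$ the most preferred vertex for $a$, among its neighbours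 and $a$ itself, that is nobody's top choice neighbour. The *valid* edges and self-loops are $(a,f(a))$, $(a,s(a))$ for $a\in A$, and $(b,b)$ for $b\in B\setminus f(A)$. An edge or self-loop is *popular* if some popular matching contains it, and *legal* if it is valid and popular. $G_0$ is the graph of popular edges on $A\cup B$. *The graph $H$.* Every vertex $u$ of $G$ has a left copy $u_\ell$ and a right copy $u_r$ in $H$. For each ordered pair $(u,v)$ of adjacent vertices of $G$ there are two parallel edges $(u_\ell^+,v_r^-)$ and $(u_\ell^-,v_r^+)$ between $u_\ell$ and $v_r$, and for each vertex $u$ there is one edge $(u_\ell^-,u_r^+)$. Every vertex of $H$ prefers edges to superscript $-$ neighbours to edges to superscript $+$ neighbours, and within each of the two classes follows its original preference order in $G$ (its own twin being last in its class). A matching in $H$ is *stable* if there is no edge $e$ of $H$ that both endpoints prefer to their assignment, and *legal* if every edge in it comes from a legal edge or self-loop of $G$. The meet (join) of two stable matchings gives every left vertex its better (worse) edge and every right vertex its worse (better) edge. *Realization.* For a matching $N$ with witness $\alpha$, $N^*_\alpha$ is the matching in $H$ consisting of $(a_\ell^-,b_r^+),(b_\ell^+,a_r^-)$ for $(a,b)\in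 N$ with $(\alpha_a,\alpha_b)=(-1,1)$; $(a_\ell^+,b_r^-),(b_\ell^-,a_r^+)$ for $(a,b)\in N$ with $(\alpha_a,\alpha_b)=(1,-1)$; $(a_\ell^-,b_r^+),(b_\ell^-,a_r^+)$ for $(a,b)\in N$ with $\alpha_a=\alpha_b=0$; and $(u_\ell^-,u_r^+)$ whenever $N(u)=u$. *The algorithm.* Gale–Shapley with forbidden edges in $H$: repeatedly, a left vertex proposes along its best edge that has not been deleted; all edges at the receiving right vertex that are worse than this edge are deleted, and so is the edge itself if it is forbidden; this stops when nothing changes any more, and the accepted edges are then the best remaining edges of the left vertices. The algorithm first runs this with all edges of $H$ coming from non-legal edges or self-loops of $G$ forbidden, obtaining $S_0$. All vertices of $A\cup B$ are initially unmarked. Given $S_{i-1}$ ($i\ge1$), let $A_-\cap A'_+$ be the set of agents $a$ such that $S_{i-1}$ contains $(a_\ell^-,b_r^+)$ and $(d_\ell^-,a_r^+)$ for some jobs $b,d$, and let $B_+\cap B'_-$ be the set of jobs $b$ such that $S_{i-1}$ contains $(a_\ell^-,b_r^+)$ and $(b_\ell^-,c_r^+)$ for some agents $a,c$. As long as there is an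 unmarked vertex in $(A_-\cap A'_+)\cup(B_+\cap B'_-)$, iteration $i$ chooses any such vertex $v$, additionally forbids all edges $(a_\ell^+,\ast)$ and $(\ast,a_r^-)$ for all agents $a$ in the connected component of $v$ in $G_0$, continues Gale–Shapley from the current set of deleted edges to obtain $S_i$, and marks all vertices of this component. Whenever a Gale–Shapley computation leaves a vertex unmatched, the algorithm stops and reports "no fully popular matching". Let $\mathcal D_i$ be the set of legal stable matchings in $H$ that avoid all edges forbidden in the first $i$ iterations. **Statement.** In every execution of the algorithm, and for every $i\ge 0$ such that the Gale–Shapley computation of iteration $i$ (for $i=0$: the initial one) is carried out: 1. $\mathcal D_i$ is closed under meet and join, i.e. it is a (possibly empty) sublattice of the lattice of stable matchings in $H$. 2. For every fully popular matching $N$ in $G$ and every witness $\alpha$ of $N$, $N^*_\alpha\in\mathcal D_i$. 3. If this computation leaves no vertex unmatched, then $S_i$ belongs to $\mathcal D_i$ and gives every left vertex the best edge that it has in any matching in $\mathcal D_i$. 4. If this computation leaves no vertex unmatched, then for every fully popular matching $N$ and every witness $\alpha$ of $N$ we have $\alpha_v=0$ for all $v\in(A_-\cap A'_+)\cup(B_+\cap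 B'_-)$, where these sets are taken with respect to $S_i$. 5. This computation leaves a vertex unmatched if and only if $\mathcal D_i=\emptyset$. Consequently, if the algorithm reports "no fully popular matching", then $G$ has no fully popular matching. -/

import Mathlib

/-- A marriage instance: a bipartite graph with agents `A` and jobs `B` in which every vertex ranks
its neighbours strictly (a smaller rank is a better rank; ranks of non-neighbours are irrelevant). -/
structure MarriageInstance (A B : Type*) where
  E : A → B → Prop
  rankA : A → B → ℕ
  rankB : B → A → ℕ
  rankA_inj : ∀ a b b', E a b → E a b' → rankA a b = rankA a b' → b = b'
  rankB_inj : ∀ b a a', E a b → E a' b → rankB b a = rankB b a' → a = a'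

/-- An edge of the auxiliary graph `H` between the left copy `left_ℓ` of a vertex and the right copy
`right_r` of a vertex.  If `leftPlus = true` it is `(left_ℓ⁺, right_r⁻)`, and if
`leftPlus = false` it is `(left_ℓ⁻, right_r⁺)`. -/
@[ext]
structure HEdge (V : Type*) where
  left : V
  right : V
  leftPlus : Bool

namespace MarriageInstance

section Graph

variable {A B : Type*} (G : MarriageInstance A B)

/-- Adjacency in `G` (without self-loops), on the vertex set `A ⊕ B`. -/
def Adj : A ⊕ B → A ⊕ B → Prop
  | Sum.inl a, Sum.inr b => G.E a b
  | Sum.inr b, Sum.inl a => G.E a b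
  | _, _ => False

/-- The rank that a vertex gives to another vertex. -/
def rank : A ⊕ B → A ⊕ B → ℕ
  | Sum.inl a, Sum.inr b => G.rankA a b
  | Sum.inr b, Sum.inl a => G.rankB b a
  | _, _ => 0

/-- `u` strictly prefers `x` to `y`, in the instance augmented with self-loops: `x` and `y` are
neighbours of `u` or `u` itself, and `u` is at the bottom of its own list. -/
def Prefers (u x y : A ⊕ B) : Prop :=
  G.Adj u x ∧ (y = u ∨ (G.Adj u y ∧ G.rank u x < G.rank u y))

/-- A matching of `G`, viewed as a perfect matching of the instance augmented with self-loops: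
`partner u = u` means that `u` is unmatched. -/
structure Matching where
  partner : A ⊕ B → A ⊕ B
  invol : ∀ u, partner (partner u) = u
  adj_or_self : ∀ u, partner u = u ∨ G.Adj u (partner u)

variable {G}

/-- The number of vertices that vote for `M` in the election between `M` and `N`. -/
noncomputable def Matching.votes (M N : G.Matching) : ℕ :=
  Set.ncard {u : A ⊕ B | G.Prefers u (M.partner u) (N.partner u)}

/-- The number of agents that vote for `M` in the election between `M` and `N`. -/
noncomputable def Matching.votesA (M N : G.Matching) : ℕ :=
  Set.ncard {a : A | G.Prefers (Sum.inl a) (M.partner (Sum.inl a)) (N.partner (Sum.inl a))}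

def Matching.Popular (M : G.Matching) : Prop :=
  ∀ N : G.Matching, N.votes M ≤ M.votes N

def Matching.APopular (M : G.Matching) : Prop :=
  ∀ N : G.Matching, N.votesA M ≤ M.votesA N

def Matching.FullyPopular (M : G.Matching) : Prop :=
  M.Popular ∧ M.APopular

open Classical in
/-- The weight `wt_M(a, b)` of an edge. -/
noncomputable def Matching.wt (M : G.Matching) (a : A) (b : B) : ℤ :=
  if G.Prefers (Sum.inl a) (Sum.inr b) (M.partner (Sum.inl a)) ∧
      G.Prefers (Sum.inr b) (Sum.inl a) (M.partner (Sum.inr b)) then 2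
  else if G.Prefers (Sum.inl a) (M.partner (Sum.inl a)) (Sum.inr b) ∧
      G.Prefers (Sum.inr b) (M.partner (Sum.inr b)) (Sum.inl a) then -2
  else 0

open Classical in
/-- The weight `wt_M(u, u)` of a self-loop. -/
noncomputable def Matching.wtLoop (M : G.Matching) (u : A ⊕ B) : ℤ :=
  if M.partner u = u then 0 else -1

/-- `α` is a witness of the popularity of `M`. -/
def Matching.IsWitness [Fintype A] [Fintype B] (M : G.Matching) (α : A ⊕ B → ℤ) : Prop :=
  (∀ u, α u = -1 ∨ α u = 0 ∨ α u = 1) ∧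
  ∑ u, α u = 0 ∧
  (∀ a b, G.E a b → M.wt a b ≤ α (Sum.inl a) + α (Sum.inr b)) ∧
  (∀ u, M.wtLoop u ≤ α u)

variable (G)

/-- `x = f(a)`, the top choice neighbour of `a`. -/
def IsFirst (a : A) (x : A ⊕ B) : Prop :=
  G.Adj (Sum.inl a) x ∧ ∀ y, G.Adj (Sum.inl a) y → ¬ G.Prefers (Sum.inl a) y x

/-- `x = s(a)`, the most preferred vertex for `a`, among its neighbours and `a` itself, that is
nobody's top choice neighbour. -/
def IsSecond (a : A) (x : A ⊕ B) : Prop :=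
  (x = Sum.inl a ∨ G.Adj (Sum.inl a) x) ∧ (∀ a', ¬ G.IsFirst a' x) ∧
  ∀ y, (y = Sum.inl a ∨ G.Adj (Sum.inl a) y) → (∀ a', ¬ G.IsFirst a' y) →
    ¬ G.Prefers (Sum.inl a) y x

/-- The edge or self-loop `{u, v}` is valid. -/
def ValidEdge (u v : A ⊕ B) : Prop :=
  (∃ a, u = Sum.inl a ∧ (G.IsFirst a v ∨ G.IsSecond a v)) ∨
  (∃ a, v = Sum.inl a ∧ (G.IsFirst a u ∨ G.IsSecond a u)) ∨
  (∃ b : B, u = Sum.inr b ∧ v = Sum.inr b ∧ ∀ a, ¬ G.IsFirst a (Sum.inr b))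

/-- The edge or self-loop `{u, v}` is popular: some popular matching contains it. -/
def PopularEdge (u v : A ⊕ B) : Prop :=
  ∃ M : G.Matching, M.Popular ∧ M.partner u = v

def LegalEdge (u v : A ⊕ B) : Prop :=
  G.ValidEdge u v ∧ G.PopularEdge u v

/-- The popular subgraph `G₀` (its self-loops play no role for connected components). -/
def popularSubgraph : SimpleGraph (A ⊕ B) :=
  SimpleGraph.fromRel G.PopularEdge

end Graph

section H

variable {A B : Type*} (G : MarriageInstance A B)

/-- The edges of `H`: two parallel edges between `u_ℓ` and `v_r` when `u` and `v` are adjacent in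
`G`, and the single edge `(u_ℓ⁻, u_r⁺)` for every vertex `u`. -/
def IsHEdge (e : HEdge (A ⊕ B)) : Prop :=
  G.Adj e.left e.right ∨ (e.left = e.right ∧ e.leftPlus = false)

/-- The common left endpoint of `e` and `f` prefers `e` to `f`: superscript `-` neighbours come
before superscript `+` neighbours, and ties are resolved by the original preferences. -/
def LeftPrefers (e f : HEdge (A ⊕ B)) : Prop :=
  e.left = f.left ∧
  ((e.leftPlus = true ∧ f.leftPlus = false) ∨
    (e.leftPlus = f.leftPlus ∧ G.Prefers e.left e.right f.right))

/-- The common right endpoint of `e` and `f` prefers `e` to `f`. -/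
def RightPrefers (e f : HEdge (A ⊕ B)) : Prop :=
  e.right = f.right ∧
  ((e.leftPlus = false ∧ f.leftPlus = true) ∨
    (e.leftPlus = f.leftPlus ∧ G.Prefers e.right e.left f.left))

def IsHMatching (M : Set (HEdge (A ⊕ B))) : Prop :=
  (∀ e ∈ M, G.IsHEdge e) ∧
  (∀ e ∈ M, ∀ f ∈ M, e.left = f.left → e = f) ∧
  (∀ e ∈ M, ∀ f ∈ M, e.right = f.right → e = f)

/-- Both endpoints of the edge `e` of `H` prefer `e` to their assignments in `M`; an unmatched
endpoint prefers `e` to being unmatched. -/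
def Blocks (e : HEdge (A ⊕ B)) (M : Set (HEdge (A ⊕ B))) : Prop :=
  G.IsHEdge e ∧
  (∀ f ∈ M, f.left = e.left → G.LeftPrefers e f) ∧
  (∀ f ∈ M, f.right = e.right → G.RightPrefers e f)

def IsHStable (M : Set (HEdge (A ⊕ B))) : Prop :=
  G.IsHMatching M ∧ ∀ e, ¬ G.Blocks e M

/-- All vertices on both sides of `H` are matched. -/
def IsHPerfect (M : Set (HEdge (A ⊕ B))) : Prop :=
  (∀ u, ∃ e ∈ M, e.left = u) ∧ (∀ v, ∃ e ∈ M, e.right = v)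

/-- The edges of `H` that are forbidden from the start. -/
def illegalHEdges : Set (HEdge (A ⊕ B)) :=
  {e | G.IsHEdge e ∧ ¬ G.LegalEdge e.left e.right}

/-- The matching has no edge that is forbidden from the start. -/
def IsHLegal (M : Set (HEdge (A ⊕ B))) : Prop :=
  ∀ e ∈ M, e ∉ G.illegalHEdges

/-- The legal stable matchings in `H` that avoid the set `F` of edges. -/
def legalStable (F : Set (HEdge (A ⊕ B))) : Set (Set (HEdge (A ⊕ B))) :=
  {M | G.IsHStable M ∧ G.IsHLegal M ∧ ∀ e ∈ M, e ∉ F}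

/-- Every left vertex takes the better of its edges in `M` and `M'`. -/
def leftBetter (M M' : Set (HEdge (A ⊕ B))) : Set (HEdge (A ⊕ B)) :=
  {e | e ∈ M ∪ M' ∧ ∀ f ∈ M ∪ M', ¬ G.LeftPrefers f e}

/-- Every left vertex takes the worse of its edges in `M` and `M'`. -/
def leftWorse (M M' : Set (HEdge (A ⊕ B))) : Set (HEdge (A ⊕ B)) :=
  {e | e ∈ M ∪ M' ∧ ∀ f ∈ M ∪ M', ¬ G.LeftPrefers e f}

/-- Every right vertex takes the better of its edges in `M` and `M'`. -/
def rightBetter (M M' : Set (HEdge (A ⊕ B))) : Set (HEdge (A ⊕ B)) :=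
  {e | e ∈ M ∪ M' ∧ ∀ f ∈ M ∪ M', ¬ G.RightPrefers f e}

/-- Every right vertex takes the worse of its edges in `M` and `M'`. -/
def rightWorse (M M' : Set (HEdge (A ⊕ B))) : Set (HEdge (A ⊕ B)) :=
  {e | e ∈ M ∪ M' ∧ ∀ f ∈ M ∪ M', ¬ G.RightPrefers e f}

/-- `K` is the meet of `M` and `M'`. -/
def IsMeet (M M' K : Set (HEdge (A ⊕ B))) : Prop :=
  K = G.leftBetter M M' ∧ K = G.rightWorse M M'

/-- `K` is the join of `M` and `M'`. -/
def IsJoin (M M' K : Set (HEdge (A ⊕ B))) : Prop :=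
  K = G.leftWorse M M' ∧ K = G.rightBetter M M'

/-- `D` is a (possibly empty) sublattice of the lattice of stable matchings in `H`. -/
def IsStableSublattice (D : Set (Set (HEdge (A ⊕ B)))) : Prop :=
  (∀ M ∈ D, G.IsHStable M) ∧
  ∀ M ∈ D, ∀ M' ∈ D, (∃ K ∈ D, G.IsMeet M M' K) ∧ (∃ K ∈ D, G.IsJoin M M' K)

variable {G}

/-- The realization `N*_α` in `H` of a matching `N` in `G` with witness `α`. -/
def Matching.realization (N : G.Matching) (α : A ⊕ B → ℤ) : Set (HEdge (A ⊕ B)) :=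
  {e | (∃ (a : A) (b : B), N.partner (Sum.inl a) = Sum.inr b ∧
          ((α (Sum.inl a) = -1 ∧ α (Sum.inr b) = 1 ∧
              (e = ⟨Sum.inl a, Sum.inr b, false⟩ ∨ e = ⟨Sum.inr b, Sum.inl a, true⟩)) ∨
           (α (Sum.inl a) = 1 ∧ α (Sum.inr b) = -1 ∧
              (e = ⟨Sum.inl a, Sum.inr b, true⟩ ∨ e = ⟨Sum.inr b, Sum.inl a, false⟩)) ∨
           (α (Sum.inl a) = 0 ∧ α (Sum.inr b) = 0 ∧
              (e = ⟨Sum.inl a, Sum.inr b, false⟩ ∨ e = ⟨Sum.inr b, Sum.inl a, false⟩)))) ∨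
       (∃ u, N.partner u = u ∧ e = ⟨u, u, false⟩)}

end H

section Algorithm

variable {A B : Type*} (G : MarriageInstance A B)

/-- `e` is the best edge of its left endpoint among the edges of `H` that are not in the set `R`
of deleted edges, so that this left endpoint (next, or currently) proposes along `e`. -/
def Proposes (R : Set (HEdge (A ⊕ B))) (e : HEdge (A ⊕ B)) : Prop :=
  G.IsHEdge e ∧ e ∉ R ∧ ∀ f, G.IsHEdge f → f ∉ R → ¬ G.LeftPrefers f e

/-- One proposal in the Gale-Shapley algorithm with set `F` of forbidden edges: a left vertex
proposes along its best edge `e` that is not deleted.  All edges at the right endpoint of `e` that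
are worse than `e` get deleted, and if `e` is forbidden, the proposal is rejected and `e` is deleted
too. -/
def GSStep (F R R' : Set (HEdge (A ⊕ B))) : Prop :=
  ∃ e, G.Proposes R e ∧
    R' = R ∪ {f | G.IsHEdge f ∧ G.RightPrefers e f} ∪ {f | f = e ∧ e ∈ F}

/-- A complete run of the Gale-Shapley algorithm with forbidden edges `F`, from the set `R` of
deleted edges to the set `R'` of deleted edges: no further proposal changes anything. -/
def GSRun (F R R' : Set (HEdge (A ⊕ B))) : Prop :=
  Relation.ReflTransGen (G.GSStep F) R R' ∧ ∀ R'', G.GSStep F R' R'' → R'' = R'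

/-- The edges that are accepted when a run of the Gale-Shapley algorithm ends with the set `R`
of deleted edges. -/
def accepted (R : Set (HEdge (A ⊕ B))) : Set (HEdge (A ⊕ B)) :=
  {e | G.Proposes R e}

/-- `A₋ ∩ A'₊` for a matching `S` in `H`. -/
def candidateAgents (S : Set (HEdge (A ⊕ B))) : Set A :=
  {a | (∃ b : B, (⟨Sum.inl a, Sum.inr b, false⟩ : HEdge (A ⊕ B)) ∈ S) ∧
       (∃ b : B, (⟨Sum.inr b, Sum.inl a, false⟩ : HEdge (A ⊕ B)) ∈ S)}

/-- `B₊ ∩ B'₋` for a matching `S` in `H`. -/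
def candidateJobs (S : Set (HEdge (A ⊕ B))) : Set B :=
  {b | (∃ a : A, (⟨Sum.inl a, Sum.inr b, false⟩ : HEdge (A ⊕ B)) ∈ S) ∧
       (∃ a : A, (⟨Sum.inr b, Sum.inl a, false⟩ : HEdge (A ⊕ B)) ∈ S)}

/-- `(A₋ ∩ A'₊) ∪ (B₊ ∩ B'₋)` for a matching `S` in `H`. -/
def candidates (S : Set (HEdge (A ⊕ B))) : Set (A ⊕ B) :=
  Sum.inl '' candidateAgents S ∪ Sum.inr '' candidateJobs S

/-- The connected component of `v` in the popular subgraph. -/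
def component (v : A ⊕ B) : Set (A ⊕ B) :=
  {u | G.popularSubgraph.Reachable v u}

/-- The edges forbidden in an iteration in which `v` is chosen: all edges `(a_ℓ⁺, *)` and
`(*, a_r⁻)` for agents `a` in the component of `v`. -/
def newlyForbidden (v : A ⊕ B) : Set (HEdge (A ⊕ B)) :=
  {e | G.IsHEdge e ∧ e.leftPlus = true ∧
    ∃ a : A, Sum.inl a ∈ G.component v ∧ (e.left = Sum.inl a ∨ e.right = Sum.inl a)}

/-- The state of the algorithm at the end of an iteration: the edges deleted by the Gale-Shapley
algorithm so far, the edges forbidden in the iterations so far (on top of the edges that are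
forbidden from the start), and the marked vertices. -/
structure AlgState (A B : Type*) where
  deleted : Set (HEdge (A ⊕ B))
  forbidden : Set (HEdge (A ⊕ B))
  marked : Set (A ⊕ B)

/-- The matching `S_i` of a state (if all vertices are matched in it). -/
def AlgState.S (s : AlgState A B) : Set (HEdge (A ⊕ B)) :=
  G.accepted s.deleted

/-- The set `D_i` of a state. -/
def AlgState.D (s : AlgState A B) : Set (Set (HEdge (A ⊕ B))) :=
  G.legalStable s.forbidden

/-- `G.Reaches i s`: some execution of the algorithm is in state `s` after line 1 (if `i = 0`) or
after the Gale-Shapley computation of its `i`-th iteration (if `0 < i`).  The algorithm goes on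
from a state only if all vertices are matched, and there is an unmarked candidate `v`. -/
inductive Reaches : ℕ → AlgState A B → Prop
  | start (R : Set (HEdge (A ⊕ B))) (hR : G.GSRun G.illegalHEdges ∅ R) :
      Reaches 0 ⟨R, ∅, ∅⟩
  | iterate (i : ℕ) (s : AlgState A B) (v : A ⊕ B) (R : Set (HEdge (A ⊕ B)))
      (hs : Reaches i s)
      (hperfect : IsHPerfect (s.S G))
      (hv : v ∈ candidates (s.S G)) (hmark : v ∉ s.marked)
      (hR : G.GSRun (G.illegalHEdges ∪ (s.forbidden ∪ G.newlyForbidden v)) s.deleted R) :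
      Reaches (i + 1)
        ⟨R, s.forbidden ∪ G.newlyForbidden v, s.marked ∪ G.component v⟩

/-- Some execution of the algorithm reports "no fully popular matching": its Gale-Shapley
computation leaves a vertex unmatched. -/
def ReportsNone : Prop :=
  ∃ i s, G.Reaches i s ∧ ¬ IsHPerfect (s.S G)

end Algorithm

end MarriageInstance

/-! Each edge of a meet or join comes from one of the two matchings, so avoiding a set of edges is
inherited. Statement 1 is therefore the classical lattice theorem, once stable matchings in H are
known to be perfect (`IsHStable.cover_left`); the twin edges force this.

Gale–Shapley never deletes an edge of a stable matching that avoids the forbidden edges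
(`GSStep.disjoint`). The deleted edges are closed downwards at every right vertex (`DeletedLower`),
so the accepted edges form a stable matching as soon as they cover all vertices. This gives
left-optimality of S_i, and a vertex stays unmatched exactly if D_i is empty.

Statements 2 and 4 feed each other through an induction on i. A witness is a dual solution, which
makes N*_α stable (`Matching.IsWitness.isHStable_realization`); its edges are popular because N is,
and valid because N is A-popular (`Matching.APopular.validEdge`). At a candidate u, left-optimality
of S_i rules out α_u = 1 and its right-pessimality rules out α_u = -1 (`Reaches.witness_eq_zero`).
Complementary slackness and parity carry the value 0 along popular edges, hence over the whole
component, where N*_α then uses none of the newly forbidden edges.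

The final claim also needs every popular matching to have a witness; this is integral duality for
weighted bipartite matching (`exists_perm_sum_eq_cover`). -/

/-! ### The lattice of perfect stable matchings. -/

/-- Two families of strict preferences over a common set of edges, one for the left and one for the
right endpoints. -/
structure BipartitePreferences (E V : Type*) where
  valid : E → Prop
  left : E → V
  right : E → V
  prefL : E → E → Prop
  prefR : E → E → Prop
  prefL_left : ∀ e f, prefL e f → left e = left f
  prefR_right : ∀ e f, prefR e f → right e = right f
  prefL_irrefl : ∀ e, ¬ prefL e e
  prefR_irrefl : ∀ e, ¬ prefR e e
  prefL_trans : ∀ e f g, prefL e f → prefL f g → prefL e g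
  prefR_trans : ∀ e f g, prefR e f → prefR f g → prefR e g
  prefL_total : ∀ e f, valid e → valid f → left e = left f → e ≠ f → prefL e f ∨ prefL f e
  prefR_total : ∀ e f, valid e → valid f → right e = right f → e ≠ f → prefR e f ∨ prefR f e

namespace BipartitePreferences

variable {E V : Type*} (P : BipartitePreferences E V)

/-- Exchange the roles of left and right. -/
def swap : BipartitePreferences E V where
  valid := P.valid
  left := P.right
  right := P.left
  prefL := P.prefR
  prefR := P.prefL
  prefL_left := P.prefR_right
  prefR_right := P.prefL_left
  prefL_irrefl := P.prefR_irrefl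
  prefR_irrefl := P.prefL_irrefl
  prefL_trans := P.prefR_trans
  prefR_trans := P.prefL_trans
  prefL_total := P.prefR_total
  prefR_total := P.prefL_total

/-- A stable matching that covers all vertices. -/
structure PerfectStable (M : Set E) : Prop where
  valid : ∀ e ∈ M, P.valid e
  inj_left : ∀ e ∈ M, ∀ f ∈ M, P.left e = P.left f → e = f
  inj_right : ∀ e ∈ M, ∀ f ∈ M, P.right e = P.right f → e = f
  cover_left : ∀ u, ∃ e ∈ M, P.left e = u
  cover_right : ∀ v, ∃ e ∈ M, P.right e = v
  not_blocks : ∀ e, P.valid e → (∀ f ∈ M, P.left f = P.left e → P.prefL e f) →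
    (∀ f ∈ M, P.right f = P.right e → P.prefR e f) → False

variable {P}

theorem PerfectStable.swap {M : Set E} (h : P.PerfectStable M) : P.swap.PerfectStable M where
  valid := h.valid
  inj_left := h.inj_right
  inj_right := h.inj_left
  cover_left := h.cover_right
  cover_right := h.cover_left
  not_blocks := fun e he h1 h2 => h.not_blocks e he h2 h1

variable (P)

/-- Every left vertex takes the better of its edges. -/
def better (M M' : Set E) : Set E :=
  {e | e ∈ M ∪ M' ∧ ∀ f ∈ M ∪ M', ¬ P.prefL f e}

/-- Every right vertex takes the worse of its edges. -/
def worse (M M' : Set E) : Set E :=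
  {e | e ∈ M ∪ M' ∧ ∀ f ∈ M ∪ M', ¬ P.prefR e f}

variable {P}

theorem better_comm (M M' : Set E) : P.better M M' = P.better M' M := by
  simp only [better, Set.union_comm]

/-- Otherwise `e` would block `M'`: being the better choice, `e` also beats the edge of its left
endpoint in `M'`. -/
theorem not_prefR_of_mem_better {M M' : Set E} (hM' : P.PerfectStable M')
    (hM : P.PerfectStable M) {e f : E} (he : e ∈ P.better M M') (heM : e ∈ M) (hf : f ∈ M') :
    ¬ P.prefR e f := by
  intro hef
  have hne : e ∉ M' := fun h => by
    have := hM'.inj_right _ h _ hf (P.prefR_right _ _ hef)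
    subst this
    exact P.prefR_irrefl _ hef
  refine hM'.not_blocks e (hM.valid _ heM) (fun g hg hge => ?_) (fun g hg hge => ?_)
  · rcases P.prefL_total e g (hM.valid _ heM) (hM'.valid _ hg) hge.symm
      (fun h => hne (h ▸ hg)) with h | h
    · exact h
    · exact absurd h (he.2 g (Or.inr hg))
  · rwa [hM'.inj_right _ hg _ hf (hge.trans (P.prefR_right _ _ hef))]

theorem better_subset_worse {M M' : Set E} (hM : P.PerfectStable M)
    (hM' : P.PerfectStable M') : P.better M M' ⊆ P.worse M M' := by
  intro e he
  refine ⟨he.1, fun f hf hef => ?_⟩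
  have hr := P.prefR_right _ _ hef
  rcases he.1 with h | h <;> rcases hf with h' | h'
  · have := hM.inj_right _ h _ h' hr
    subst this
    exact P.prefR_irrefl _ hef
  · exact not_prefR_of_mem_better hM' hM he h h' hef
  · exact not_prefR_of_mem_better hM hM' (better_comm M M' ▸ he) h h' hef
  · have := hM'.inj_right _ h _ h' hr
    subst this
    exact P.prefR_irrefl _ hef

theorem PerfectStable.valid_union {M M' : Set E} (hM : P.PerfectStable M)
    (hM' : P.PerfectStable M') {e : E} (he : e ∈ M ∪ M') : P.valid e :=
  he.elim (hM.valid e) (hM'.valid e)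

theorem worse_inj_right {M M' : Set E} (hM : P.PerfectStable M) (hM' : P.PerfectStable M')
    {e f : E} (he : e ∈ P.worse M M') (hf : f ∈ P.worse M M') (hef : P.right e = P.right f) :
    e = f := by
  by_contra hne
  rcases P.prefR_total e f (hM.valid_union hM' he.1) (hM.valid_union hM' hf.1) hef hne with h | h
  · exact he.2 f hf.1 h
  · exact hf.2 e he.1 h

theorem better_inj_left {M M' : Set E} (hM : P.PerfectStable M) (hM' : P.PerfectStable M')
    {e f : E} (he : e ∈ P.better M M') (hf : f ∈ P.better M M') (hef : P.left e = P.left f) :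
    e = f := by
  by_contra hne
  rcases P.prefL_total e f (hM.valid_union hM' he.1) (hM.valid_union hM' hf.1) hef hne with h | h
  · exact hf.2 e he.1 h
  · exact he.2 f hf.1 h

theorem better_cover_left {M M' : Set E} (hM : P.PerfectStable M) (hM' : P.PerfectStable M')
    (u : V) : ∃ e ∈ P.better M M', P.left e = u := by
  obtain ⟨e, he, heu⟩ := hM.cover_left u
  obtain ⟨f, hf, hfu⟩ := hM'.cover_left u
  have key : ∀ g ∈ M ∪ M', P.left g = u → g = e ∨ g = f := by
    rintro g (hg | hg) hgu
    · exact Or.inl (hM.inj_left _ hg _ he (hgu.trans heu.symm))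
    · exact Or.inr (hM'.inj_left _ hg _ hf (hgu.trans hfu.symm))
  by_cases hfe : P.prefL f e
  · refine ⟨f, ⟨Or.inr hf, fun g hg hgf => ?_⟩, hfu⟩
    rcases key g hg ((P.prefL_left _ _ hgf).trans hfu) with rfl | rfl
    · exact P.prefL_irrefl _ (P.prefL_trans _ _ _ hgf hfe)
    · exact P.prefL_irrefl _ hgf
  · refine ⟨e, ⟨Or.inl he, fun g hg hge => ?_⟩, heu⟩
    rcases key g hg ((P.prefL_left _ _ hge).trans heu) with rfl | rfl
    · exact P.prefL_irrefl _ hge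
    · exact hfe hge

/-- A set of edges that covers every left vertex and is injective on right endpoints covers every
right vertex. -/
theorem cover_right_of_cover_left {V : Type*} [Finite V] {l r : E → V} {K : Set E}
    (hl : ∀ u, ∃ e ∈ K, l e = u) (hr : ∀ e ∈ K, ∀ f ∈ K, r e = r f → e = f) (v : V) :
    ∃ e ∈ K, r e = v := by
  choose k hk hkl using hl
  have hinj : Function.Injective (fun u => r (k u)) := fun u u' h => by
    rw [← hkl u, ← hkl u', hr _ (hk u) _ (hk u') h]
  obtain ⟨u, hu⟩ := (Finite.injective_iff_surjective.1 hinj) v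
  exact ⟨k u, hk u, hu⟩

theorem better_cover_right [Finite V] {M M' : Set E} (hM : P.PerfectStable M)
    (hM' : P.PerfectStable M') (v : V) : ∃ e ∈ P.better M M', P.right e = v :=
  cover_right_of_cover_left (better_cover_left hM hM')
    (fun _ he _ hf => worse_inj_right hM hM' (better_subset_worse hM hM' he)
      (better_subset_worse hM hM' hf)) v

/-- `better` lies inside `worse` and, by counting, already covers every right vertex, while `worse`
has at most one edge at each of them. -/
theorem better_eq_worse [Finite V] {M M' : Set E} (hM : P.PerfectStable M)
    (hM' : P.PerfectStable M') : P.better M M' = P.worse M M' := by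
  refine (better_subset_worse hM hM').antisymm fun e he => ?_
  obtain ⟨k, hk, hke⟩ := better_cover_right hM hM' (P.right e)
  exact worse_inj_right hM hM' (better_subset_worse hM hM' hk) he hke ▸ hk

theorem better_perfectStable [Finite V] {M M' : Set E} (hM : P.PerfectStable M)
    (hM' : P.PerfectStable M') : P.PerfectStable (P.better M M') where
  valid := fun e he => hM.valid_union hM' he.1
  inj_left := fun _ he _ hf => better_inj_left hM hM' he hf
  inj_right := fun _ he _ hf => worse_inj_right hM hM' (better_subset_worse hM hM' he)
    (better_subset_worse hM hM' hf)
  cover_left := better_cover_left hM hM'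
  cover_right := better_cover_right hM hM'
  not_blocks := by
    intro e he hl hr
    obtain ⟨g, hg, hge⟩ := better_cover_right hM hM' (P.right e)
    obtain ⟨k, hk, hke⟩ := better_cover_left hM hM' (P.left e)
    -- On the left, a blocking edge beats the edges of both matchings. On the right it beats `g`,
    -- which lies in one of them, and so it blocks that matching.
    have hL : ∀ f ∈ M ∪ M', P.left f = P.left e → P.prefL e f := by
      intro f hf hfe
      have hek := hl k hk hke
      by_cases hfk : k = f
      · exact hfk ▸ hek
      · rcases P.prefL_total k f (hM.valid_union hM' hk.1) (hM.valid_union hM' hf)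
          (hke.trans hfe.symm) hfk with h | h
        · exact P.prefL_trans _ _ _ hek h
        · exact absurd h (hk.2 f hf)
    have heg := hr g hg hge
    rcases hg.1 with h | h
    · exact hM.not_blocks e he (fun f hf => hL f (Or.inl hf))
        (fun f hf hfe => hM.inj_right _ hf _ h (hfe.trans hge.symm) ▸ heg)
    · exact hM'.not_blocks e he (fun f hf => hL f (Or.inr hf))
        (fun f hf hfe => hM'.inj_right _ hf _ h (hfe.trans hge.symm) ▸ heg)

end BipartitePreferences

/-! ### Preferences in H are strict linear orders. -/

namespace MarriageInstance

theorem hEdge_finite (V : Type*) [Finite V] : Finite (HEdge V) :=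
  Finite.of_injective (fun e => (e.left, e.right, e.leftPlus)) (by
    rintro ⟨a, b, c⟩ ⟨a', b', c'⟩ h
    simpa using h)

section Orders

variable {A B : Type*} (G : MarriageInstance A B)

theorem adj_symm {u v : A ⊕ B} (h : G.Adj u v) : G.Adj v u := by
  rcases u with u | u <;> rcases v with v | v <;> exact h

theorem adj_irrefl (u : A ⊕ B) : ¬ G.Adj u u := by
  rcases u with u | u <;> exact id

theorem rank_inj {u x y : A ⊕ B} (hx : G.Adj u x) (hy : G.Adj u y)
    (h : G.rank u x = G.rank u y) : x = y := by
  rcases u with u | u <;> rcases x with x | x <;> rcases y with y | y <;>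
    first
    | exact hx.elim
    | exact hy.elim
    | exact congrArg _ (G.rankA_inj _ _ _ hx hy h)
    | exact congrArg _ (G.rankB_inj _ _ _ hx hy h)

theorem prefers_irrefl (u x : A ⊕ B) : ¬ G.Prefers u x x := by
  rintro ⟨h, rfl | h'⟩
  · exact G.adj_irrefl _ h
  · exact lt_irrefl _ h'.2

theorem Prefers.trans {u x y z : A ⊕ B} (h : G.Prefers u x y) (h' : G.Prefers u y z) :
    G.Prefers u x z := by
  refine ⟨h.1, h'.2.imp id fun hz => ⟨hz.1, ?_⟩⟩
  rcases h.2 with rfl | hy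
  · exact absurd h'.1 (G.adj_irrefl _)
  · exact hy.2.trans hz.2

theorem not_prefers_self (u x : A ⊕ B) : ¬ G.Prefers u u x := fun h => G.adj_irrefl _ h.1

theorem prefers_total {u x y : A ⊕ B} (hx : x = u ∨ G.Adj u x) (hy : y = u ∨ G.Adj u y)
    (hne : x ≠ y) : G.Prefers u x y ∨ G.Prefers u y x := by
  rcases hx with rfl | hx
  · rcases hy with rfl | hy
    · exact absurd rfl hne
    · exact Or.inr ⟨hy, Or.inl rfl⟩
  · rcases hy with rfl | hy
    · exact Or.inl ⟨hx, Or.inl rfl⟩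
    · rcases lt_trichotomy (G.rank u x) (G.rank u y) with h | h | h
      · exact Or.inl ⟨hx, Or.inr ⟨hy, h⟩⟩
      · exact absurd (G.rank_inj hx hy h) hne
      · exact Or.inr ⟨hy, Or.inr ⟨hx, h⟩⟩

/-- The preferences of the left and right vertices of `H`. -/
def hPreferences : BipartitePreferences (HEdge (A ⊕ B)) (A ⊕ B) where
  valid := G.IsHEdge
  left := HEdge.left
  right := HEdge.right
  prefL := G.LeftPrefers
  prefR := G.RightPrefers
  prefL_left := fun _ _ h => h.1
  prefR_right := fun _ _ h => h.1
  prefL_irrefl := by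
    rintro e ⟨-, h | h⟩
    · simp [h.1] at h
    · exact G.prefers_irrefl _ _ h.2
  prefR_irrefl := by
    rintro e ⟨-, h | h⟩
    · simp [h.1] at h
    · exact G.prefers_irrefl _ _ h.2
  prefL_trans := by
    rintro ⟨e1, e2, e3⟩ ⟨f1, f2, f3⟩ ⟨g1, g2, g3⟩ ⟨h1, h2⟩ ⟨h3, h4⟩
    dsimp only at h1 h2 h3 h4
    subst h1 h3
    refine ⟨rfl, ?_⟩
    dsimp only
    rcases h2 with h2 | h2 <;> rcases h4 with h4 | h4
    · exact Or.inl ⟨h2.1, h4.2⟩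
    · exact Or.inl ⟨h2.1, h4.1 ▸ h2.2⟩
    · exact Or.inl ⟨h2.1.trans h4.1, h4.2⟩
    · exact Or.inr ⟨h2.1.trans h4.1, h2.2.trans G h4.2⟩
  prefR_trans := by
    rintro ⟨e1, e2, e3⟩ ⟨f1, f2, f3⟩ ⟨g1, g2, g3⟩ ⟨h1, h2⟩ ⟨h3, h4⟩
    dsimp only at h1 h2 h3 h4
    subst h1 h3
    refine ⟨rfl, ?_⟩
    dsimp only
    rcases h2 with h2 | h2 <;> rcases h4 with h4 | h4
    · exact Or.inl ⟨h2.1, h4.2⟩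
    · exact Or.inl ⟨h2.1, h4.1 ▸ h2.2⟩
    · exact Or.inl ⟨h2.1.trans h4.1, h4.2⟩
    · exact Or.inr ⟨h2.1.trans h4.1, h2.2.trans G h4.2⟩
  prefL_total := by
    rintro ⟨e1, e2, e3⟩ ⟨f1, f2, f3⟩ he hf h hne
    dsimp only at h
    subst h
    by_cases h : e3 = f3
    · subst h
      have hx : e2 = e1 ∨ G.Adj e1 e2 := he.symm.imp (fun h => h.1.symm) id
      have hy : f2 = e1 ∨ G.Adj e1 f2 := hf.symm.imp (fun h => h.1.symm) id
      exact (G.prefers_total hx hy (fun h => hne (h ▸ rfl))).imp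
        (fun h => ⟨rfl, Or.inr ⟨rfl, h⟩⟩) (fun h => ⟨rfl, Or.inr ⟨rfl, h⟩⟩)
    · cases e3 <;> cases f3
      · exact absurd rfl h
      · exact Or.inr ⟨rfl, Or.inl ⟨rfl, rfl⟩⟩
      · exact Or.inl ⟨rfl, Or.inl ⟨rfl, rfl⟩⟩
      · exact absurd rfl h
  prefR_total := by
    rintro ⟨e1, e2, e3⟩ ⟨f1, f2, f3⟩ he hf h hne
    dsimp only at h
    subst h
    by_cases h : e3 = f3
    · subst h
      have hx : e1 = e2 ∨ G.Adj e2 e1 := he.symm.imp (fun h => h.1) G.adj_symm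
      have hy : f1 = e2 ∨ G.Adj e2 f1 := hf.symm.imp (fun h => h.1) G.adj_symm
      exact (G.prefers_total hx hy (fun h => hne (h ▸ rfl))).imp
        (fun h => ⟨rfl, Or.inr ⟨rfl, h⟩⟩) (fun h => ⟨rfl, Or.inr ⟨rfl, h⟩⟩)
    · cases e3 <;> cases f3
      · exact absurd rfl h
      · exact Or.inl ⟨rfl, Or.inl ⟨rfl, rfl⟩⟩
      · exact Or.inr ⟨rfl, Or.inl ⟨rfl, rfl⟩⟩
      · exact absurd rfl h

end Orders

/-! ### Stable matchings in H are perfect and form a lattice. -/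

section Perfect

variable {A B : Type*} {G : MarriageInstance A B}

/-- If a left vertex prefers an edge `e` to its edge `f` in a stable matching, then the right
endpoint of `e` has an edge that is at least as good as `e`. -/
theorem IsHStable.exists_right_of_left {M : Set (HEdge (A ⊕ B))} (hM : G.IsHStable M)
    {e : HEdge (A ⊕ B)} (he : G.IsHEdge e)
    (hl : ∀ f ∈ M, f.left = e.left → G.LeftPrefers e f) :
    ∃ f ∈ M, G.RightPrefers f e := by
  have h := hM.2 e
  simp only [Blocks, not_and, not_forall] at h
  obtain ⟨f, hf, hfr, hn⟩ := h he hl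
  refine ⟨f, hf, ?_⟩
  have hne : e ≠ f := fun h => by
    subst h
    exact G.hPreferences.prefL_irrefl e (hl e hf rfl)
  exact (G.hPreferences.prefR_total e f he (hM.1.1 f hf) hfr.symm hne).resolve_left hn

/-- An unmatched left copy of `u` starts an alternating chain, since the twin edge of `u` must not
block. The chain can always be continued and, by finiteness, returns to an edge of `M` at that left
copy. -/
theorem IsHStable.cover_left [Finite A] [Finite B] {M : Set (HEdge (A ⊕ B))}
    (hM : G.IsHStable M) (u : A ⊕ B) : ∃ e ∈ M, e.left = u := by
  by_contra hu
  push Not at hu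
  have hfree : ∀ {e : HEdge (A ⊕ B)}, e.left = u → ∀ f ∈ M, f.left = e.left →
      G.LeftPrefers e f := fun h f hf hfe => absurd (hfe.trans h) (hu f hf)
  -- For `(w_ℓ⁻, x_r⁺)` in `Q`, the vertex `w` prefers the partner `y` of `w_r` to the partner `x`
  -- of `w_ℓ`. As `(w_ℓ⁻, y_r⁺)` does not block, `y_r` has an even better partner, so the edge
  -- `(y_ℓ⁻, w_r⁺)` is again in `Q`.
  let Q : Set (HEdge (A ⊕ B)) := {e | e ∈ M ∧ e.leftPlus = false ∧
    ∃ y, (⟨y, e.left, false⟩ : HEdge (A ⊕ B)) ∈ M ∧ G.Prefers e.left y e.right}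
  have step : ∀ e : Q, ∃ e' : Q, e'.1.right = e.1.left := by
    rintro ⟨⟨w, x, t⟩, he, ht, y, hy, hyx⟩
    dsimp only at ht hyx hy ⊢
    subst ht
    obtain ⟨f, hf, hfr⟩ := hM.exists_right_of_left (e := ⟨w, y, false⟩) (Or.inl hyx.1) (by
      intro f hf hfw
      have := hM.1.2.1 f hf _ he hfw
      subst this
      exact ⟨rfl, Or.inr ⟨rfl, hyx⟩⟩)
    obtain ⟨z, y', t⟩ := f
    obtain ⟨h1, h2⟩ := hfr
    dsimp only at h1 h2
    subst h1
    have h3 : t = false ∧ G.Prefers y' z w := by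
      rcases h2 with h2 | h2
      · simp at h2
      · exact h2
    obtain ⟨rfl, h3⟩ := h3
    exact ⟨⟨⟨y', w, false⟩, hy, rfl, z, hf, h3⟩, rfl⟩
  choose nxt hnxt using step
  have hinj : Function.Injective nxt := by
    intro e f hef
    have : e.1.left = f.1.left := by rw [← hnxt e, ← hnxt f, hef]
    exact Subtype.ext (hM.1.2.1 _ e.2.1 _ f.2.1 this)
  have hfinE := hEdge_finite (A ⊕ B)
  -- The twin edge of `u` shows that `u_r` has a partner `w` in `M`. The edge from `u_ℓ` to `w_r`
  -- then shows that the edge of `M` at `u_r` lies in `Q`.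
  obtain ⟨f, hf, hfr⟩ := hM.exists_right_of_left (e := ⟨u, u, false⟩) (Or.inr ⟨rfl, rfl⟩)
    (hfree rfl)
  obtain ⟨w, u', t⟩ := f
  obtain ⟨h1, h2⟩ := hfr
  dsimp only at h1 h2
  subst h1
  have h3 : t = false ∧ G.Prefers u' w u' := by
    rcases h2 with h2 | h2
    · simp at h2
    · exact h2
  obtain ⟨rfl, h3⟩ := h3
  obtain ⟨f, hg, hgr⟩ := hM.exists_right_of_left (e := ⟨u', w, false⟩) (Or.inl h3.1) (hfree rfl)
  obtain ⟨z, w', t⟩ := f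
  obtain ⟨h1, h5⟩ := hgr
  dsimp only at h1 h5
  subst h1
  have h4 : t = false ∧ G.Prefers w' z u' := by
    rcases h5 with h5 | h5
    · simp at h5
    · exact h5
  obtain ⟨rfl, h4⟩ := h4
  -- An injection of a finite set into itself is onto, so the edge of `Q` at `u_r` has a
  -- predecessor. Its left endpoint is `u`, which was assumed uncovered.
  obtain ⟨e, he⟩ := (Finite.injective_iff_surjective.1 hinj) ⟨⟨w', u', false⟩, hf, rfl, z, hg, h4⟩
  have := hnxt e
  rw [he] at this
  exact hu e.1 e.2.1 this.symm

theorem IsHStable.perfectStable [Finite A] [Finite B] {M : Set (HEdge (A ⊕ B))}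
    (hM : G.IsHStable M) : G.hPreferences.PerfectStable M where
  valid := hM.1.1
  inj_left := hM.1.2.1
  inj_right := hM.1.2.2
  cover_left := hM.cover_left
  cover_right := BipartitePreferences.cover_right_of_cover_left hM.cover_left hM.1.2.2
  not_blocks := fun e he hl hr => hM.2 e ⟨he, hl, hr⟩

theorem isHStable_of_perfectStable {M : Set (HEdge (A ⊕ B))}
    (hM : G.hPreferences.PerfectStable M) : G.IsHStable M :=
  ⟨⟨hM.valid, hM.inj_left, hM.inj_right⟩, fun e he => hM.not_blocks e he.1 he.2.1 he.2.2⟩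

theorem isStableSublattice_legalStable [Finite A] [Finite B] (F : Set (HEdge (A ⊕ B))) :
    G.IsStableSublattice (G.legalStable F) := by
  refine ⟨fun M hM => hM.1, fun M hM M' hM' => ?_⟩
  have h := hM.1.perfectStable
  have h' := hM'.1.perfectStable
  have hsub : ∀ K, G.IsHStable K → K ⊆ M ∪ M' → K ∈ G.legalStable F := fun K hK hKM =>
    ⟨hK, fun e he => (hKM he).elim (hM.2.1 e) (hM'.2.1 e),
      fun e he => (hKM he).elim (hM.2.2 e) (hM'.2.2 e)⟩
  -- The join is the meet with the two sides exchanged.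
  refine ⟨⟨G.leftBetter M M', ?_, rfl, BipartitePreferences.better_eq_worse h h'⟩,
    ⟨G.rightBetter M M', ?_, (BipartitePreferences.better_eq_worse h.swap h'.swap), rfl⟩⟩
  · exact hsub _ (isHStable_of_perfectStable (BipartitePreferences.better_perfectStable h h'))
      fun e he => he.1
  · exact hsub _ (isHStable_of_perfectStable
      (BipartitePreferences.better_perfectStable h.swap h'.swap).swap) fun e he => he.1

end Perfect

end MarriageInstance

/-! ### Gale–Shapley with forbidden edges. -/

namespace MarriageInstance

section GaleShapley

variable {A B : Type*} {G : MarriageInstance A B}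

/-- A left vertex with an edge that is not deleted proposes along some edge. -/
theorem exists_proposes [Finite A] [Finite B] {R : Set (HEdge (A ⊕ B))} {e : HEdge (A ⊕ B)}
    (he : G.IsHEdge e) (heR : e ∉ R) : ∃ f, G.Proposes R f ∧ f.left = e.left := by
  have := hEdge_finite (A ⊕ B)
  have : IsTrans (HEdge (A ⊕ B)) G.LeftPrefers := ⟨G.hPreferences.prefL_trans⟩
  have : Std.Irrefl G.LeftPrefers := ⟨G.hPreferences.prefL_irrefl⟩
  obtain ⟨m, hm, hmin⟩ := (Finite.wellFounded_of_trans_of_irrefl G.LeftPrefers).has_min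
    {f | G.IsHEdge f ∧ f ∉ R ∧ f.left = e.left} ⟨e, he, heR, rfl⟩
  exact ⟨m, ⟨hm.1, hm.2.1, fun f hf hfR hfm => hmin f ⟨hf, hfR, hfm.1.trans hm.2.2⟩ hfm⟩, hm.2.2⟩

theorem Proposes.eq_or_leftPrefers {R : Set (HEdge (A ⊕ B))} {e f : HEdge (A ⊕ B)}
    (he : G.Proposes R e) (hf : G.IsHEdge f) (hfR : f ∉ R) (hef : e.left = f.left) :
    e = f ∨ G.LeftPrefers e f := by
  by_cases h : e = f
  · exact Or.inl h
  · exact Or.inr ((G.hPreferences.prefL_total e f he.1 hf hef h).resolve_right (he.2.2 f hf hfR))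

/-- The deleted edges form a lower set in the preferences of every right vertex. -/
def DeletedLower (G : MarriageInstance A B) (R : Set (HEdge (A ⊕ B))) : Prop :=
  ∀ f ∈ R, ∀ g, G.IsHEdge g → G.RightPrefers f g → g ∈ R

/-- A rejected forbidden edge is deleted together with everything worse at its right endpoint, so
rejections do not break the closure. -/
theorem GSStep.deletedLower {F R R' : Set (HEdge (A ⊕ B))} (h : G.GSStep F R R')
    (hR : G.DeletedLower R) : G.DeletedLower R' := by
  obtain ⟨e, -, rfl⟩ := h
  rintro f ((hf | hf) | hf) g hg hfg
  · exact Or.inl (Or.inl (hR f hf g hg hfg))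
  · exact Or.inl (Or.inr ⟨hg, G.hPreferences.prefR_trans _ _ _ hf.2 hfg⟩)
  · obtain ⟨rfl, -⟩ := hf
    exact Or.inl (Or.inr ⟨hg, hfg⟩)

/-- A step does not delete any edge of a stable matching that avoids the forbidden edges. -/
theorem GSStep.disjoint {F R R' M : Set (HEdge (A ⊕ B))} (h : G.GSStep F R R')
    (hM : G.IsHStable M) (hMF : ∀ e ∈ M, e ∉ F) (hMR : ∀ e ∈ M, e ∉ R) : ∀ e ∈ M, e ∉ R' := by
  obtain ⟨e, he, rfl⟩ := h
  rintro f hf ((hfR | hfR) | ⟨rfl, hfF⟩)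
  · exact hMR f hf hfR
  · have heM : e ∉ M := fun heM => by
      have := hM.1.2.2 e heM f hf hfR.2.1
      subst this
      exact G.hPreferences.prefR_irrefl _ hfR.2
    -- No edge of `M` has been deleted so far, so the proposal `e` beats the edge of its left
    -- endpoint in `M`. On the right it beats `f`, so it would block `M`.
    refine hM.2 e ⟨he.1, fun g hg hge => ?_, fun g hg hge => ?_⟩
    · exact (he.eq_or_leftPrefers (hM.1.1 g hg) (hMR g hg) hge.symm).resolve_left
        fun h => heM (h ▸ hg)
    · rw [hM.1.2.2 g hg f hf (hge.trans hfR.2.1)]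
      exact hfR.2
  · exact hMF f hf hfF

theorem GSRun.deletedLower {F R R' : Set (HEdge (A ⊕ B))} (h : G.GSRun F R R')
    (hR : G.DeletedLower R) : G.DeletedLower R' := by
  obtain ⟨h, -⟩ := h
  induction h with
  | refl => exact hR
  | tail _ h ih => exact h.deletedLower ih

theorem GSRun.disjoint {F R R' M : Set (HEdge (A ⊕ B))} (h : G.GSRun F R R')
    (hM : G.IsHStable M) (hMF : ∀ e ∈ M, e ∉ F) (hMR : ∀ e ∈ M, e ∉ R) : ∀ e ∈ M, e ∉ R' := by
  obtain ⟨h, -⟩ := h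
  induction h with
  | refl => exact hMR
  | tail _ h ih => exact h.disjoint hM hMF ih

/-- No further proposal changes the set of deleted edges. -/
def GSFinal (G : MarriageInstance A B) (F R : Set (HEdge (A ⊕ B))) : Prop :=
  ∀ R', G.GSStep F R R' → R' = R

/-- Repeating the proposal `e` changes nothing in a final state, so whatever it would delete is
already gone. -/
theorem GSFinal.not_rightPrefers {F R : Set (HEdge (A ⊕ B))} (h : G.GSFinal F R)
    {e f : HEdge (A ⊕ B)} (he : e ∈ G.accepted R) (hf : f ∈ G.accepted R) :
    ¬ G.RightPrefers e f := fun hef =>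
  hf.2.1 (h _ ⟨e, he, rfl⟩ ▸ Or.inl (Or.inr ⟨hf.1, hef⟩))

theorem GSFinal.not_forbidden {F R : Set (HEdge (A ⊕ B))} (h : G.GSFinal F R)
    {e : HEdge (A ⊕ B)} (he : e ∈ G.accepted R) : e ∉ F := fun heF =>
  he.2.1 (h _ ⟨e, he, rfl⟩ ▸ Or.inr ⟨rfl, heF⟩)

theorem GSFinal.isHMatching {F R : Set (HEdge (A ⊕ B))} (h : G.GSFinal F R) :
    G.IsHMatching (G.accepted R) := by
  refine ⟨fun e he => he.1, fun e he f hf hef => ?_, fun e he f hf hef => ?_⟩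
  · exact (he.eq_or_leftPrefers hf.1 hf.2.1 hef).resolve_right (hf.2.2 e he.1 he.2.1)
  · by_contra hne
    rcases G.hPreferences.prefR_total e f he.1 hf.1 hef hne with h' | h'
    · exact h.not_rightPrefers he hf h'
    · exact h.not_rightPrefers hf he h'

theorem GSFinal.isHStable {F R : Set (HEdge (A ⊕ B))} (h : G.GSFinal F R)
    (hR : G.DeletedLower R) (hp : IsHPerfect (G.accepted R)) : G.IsHStable (G.accepted R) := by
  refine ⟨h.isHMatching, fun e he => ?_⟩
  obtain ⟨f, hf, hfe⟩ := hp.1 e.left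
  obtain ⟨g, hg, hge⟩ := hp.2 e.right
  -- A blocking edge must have been deleted, since its left endpoint would otherwise propose along
  -- it or something better. The worse accepted edge `g` at its right endpoint would then be deleted
  -- too.
  have heR : e ∈ R := by
    by_contra heR
    exact hf.2.2 e he.1 heR (he.2.1 f hf hfe)
  exact hg.2.1 (hR e heR g hg.1 (he.2.2 g hg hge))

/-- If some stable matching avoids the deleted edges, then all vertices are matched. -/
theorem GSFinal.isHPerfect [Finite A] [Finite B] {F R M : Set (HEdge (A ⊕ B))}
    (h : G.GSFinal F R) (hM : G.IsHStable M) (hMR : ∀ e ∈ M, e ∉ R) :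
    IsHPerfect (G.accepted R) := by
  have hl : ∀ u, ∃ e ∈ G.accepted R, e.left = u := fun u => by
    obtain ⟨e, he, rfl⟩ := hM.cover_left u
    exact exists_proposes (hM.1.1 e he) (hMR e he)
  exact ⟨hl, BipartitePreferences.cover_right_of_cover_left hl h.isHMatching.2.2⟩

theorem legalStable_iff {F M : Set (HEdge (A ⊕ B))} :
    M ∈ G.legalStable F ↔ G.IsHStable M ∧ ∀ e ∈ M, e ∉ G.illegalHEdges ∪ F :=
  ⟨fun h => ⟨h.1, fun e he => fun h' => h'.elim (h.2.1 e he) (h.2.2 e he)⟩,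
    fun h => ⟨h.1, fun e he h' => h.2 e he (Or.inl h'), fun e he h' => h.2 e he (Or.inr h')⟩⟩

theorem Reaches.final {i : ℕ} {s : AlgState A B} (h : G.Reaches i s) :
    G.GSFinal (G.illegalHEdges ∪ s.forbidden) s.deleted := by
  cases h with
  | start R hR =>
    simp only [Set.union_empty]
    exact hR.2
  | iterate i s v R hs hperfect hv hmark hR => exact hR.2

theorem Reaches.deletedLower {i : ℕ} {s : AlgState A B} (h : G.Reaches i s) :
    G.DeletedLower s.deleted := by
  induction h with
  | start R hR => exact hR.deletedLower fun f hf => hf.elim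
  | iterate i s v R hs hperfect hv hmark hR ih => exact hR.deletedLower ih

theorem Reaches.disjoint {i : ℕ} {s : AlgState A B} (h : G.Reaches i s) :
    ∀ M ∈ s.D G, ∀ e ∈ M, e ∉ s.deleted := by
  induction h with
  | start R hR =>
    intro M hM
    exact hR.disjoint hM.1 hM.2.1 fun _ _ => id
  | iterate i s v R hs hperfect hv hmark hR ih =>
    intro M hM
    have hM' := legalStable_iff.1 hM
    exact hR.disjoint hM'.1 hM'.2
      (ih M ⟨hM.1, hM.2.1, fun e he h => hM.2.2 e he (Or.inl h)⟩)

theorem Reaches.mem_D {i : ℕ} {s : AlgState A B} (h : G.Reaches i s)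
    (hp : IsHPerfect (s.S G)) : s.S G ∈ s.D G :=
  legalStable_iff.2 ⟨h.final.isHStable h.deletedLower hp, fun _ => h.final.not_forbidden⟩

theorem Reaches.left_optimal {i : ℕ} {s : AlgState A B} (h : G.Reaches i s)
    {M : Set (HEdge (A ⊕ B))} (hM : M ∈ s.D G) {e f : HEdge (A ⊕ B)} (he : e ∈ s.S G)
    (hf : f ∈ M) (hef : e.left = f.left) : e = f ∨ G.LeftPrefers e f :=
  Proposes.eq_or_leftPrefers he (hM.1.1.1 f hf) (h.disjoint M hM f hf) hef

/-- The left-optimal matching gives every right vertex its worst edge. -/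
theorem Reaches.right_pessimal {i : ℕ} {s : AlgState A B} (h : G.Reaches i s)
    {M : Set (HEdge (A ⊕ B))} (hM : M ∈ s.D G) {e f : HEdge (A ⊕ B)} (he : e ∈ s.S G)
    (hf : f ∈ M) : ¬ G.RightPrefers e f := by
  intro hef
  have heM : e ∉ M := fun heM => by
    have := hM.1.1.2.2 e heM f hf hef.1
    subst this
    exact G.hPreferences.prefR_irrefl _ hef
  refine hM.1.2 e ⟨he.1, fun g hg hge => ?_, fun g hg hge => ?_⟩
  · exact (h.left_optimal hM he hg hge.symm).resolve_left fun h => heM (h ▸ hg)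
  · rwa [hM.1.1.2.2 g hg f hf (hge.trans hef.1)]

theorem Reaches.not_isHPerfect_iff [Finite A] [Finite B] {i : ℕ} {s : AlgState A B}
    (h : G.Reaches i s) : ¬ IsHPerfect (s.S G) ↔ s.D G = ∅ := by
  rw [Set.eq_empty_iff_forall_notMem, not_iff_comm, not_forall_not]
  exact ⟨fun ⟨M, hM⟩ => h.final.isHPerfect hM.1 (h.disjoint M hM), fun hp => ⟨_, h.mem_D hp⟩⟩

end GaleShapley

end MarriageInstance

/-! ### Votes and edge weights. -/

namespace MarriageInstance

section Votes

variable {A B : Type*} {G : MarriageInstance A B}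

open Classical in
/-- The vote of `u` for `x` against its partner in `N`. -/
noncomputable def Matching.vote (N : G.Matching) (u x : A ⊕ B) : ℤ :=
  (if G.Prefers u x (N.partner u) then 1 else 0) - (if G.Prefers u (N.partner u) x then 1 else 0)

theorem Prefers.asymm {u x y : A ⊕ B} (h : G.Prefers u x y) : ¬ G.Prefers u y x :=
  fun h' => G.prefers_irrefl _ _ (h.trans G h')

theorem Matching.vote_eq_one (N : G.Matching) {u x : A ⊕ B} (h : G.Prefers u x (N.partner u)) :
    N.vote u x = 1 := by
  simp [vote, h, h.asymm]

theorem Matching.vote_eq_neg_one (N : G.Matching) {u x : A ⊕ B}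
    (h : G.Prefers u (N.partner u) x) : N.vote u x = -1 := by
  simp [vote, h, h.asymm]

theorem Matching.neg_one_le_vote (N : G.Matching) (u x : A ⊕ B) : -1 ≤ N.vote u x := by
  unfold vote
  split_ifs <;> norm_num

theorem Matching.vote_partner (N : G.Matching) (u : A ⊕ B) : N.vote u (N.partner u) = 0 := by
  simp [vote, G.prefers_irrefl]

theorem Matching.vote_eq_one_or (N : G.Matching) {u x : A ⊕ B} (hx : x = u ∨ G.Adj u x)
    (h : N.partner u ≠ x) :
    (G.Prefers u x (N.partner u) ∧ N.vote u x = 1) ∨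
      (G.Prefers u (N.partner u) x ∧ N.vote u x = -1) :=
  (G.prefers_total (N.adj_or_self u) hx h).symm.imp (fun h => ⟨h, N.vote_eq_one h⟩)
    (fun h => ⟨h, N.vote_eq_neg_one h⟩)

theorem Matching.partner_eq_comm (N : G.Matching) {u v : A ⊕ B} :
    N.partner u = v ↔ N.partner v = u :=
  ⟨fun h => h ▸ N.invol u, fun h => h ▸ N.invol v⟩

theorem Matching.wt_eq_vote_add_vote (N : G.Matching) {a : A} {b : B} (h : G.E a b) :
    N.wt a b = N.vote (Sum.inl a) (Sum.inr b) + N.vote (Sum.inr b) (Sum.inl a) := by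
  by_cases hab : N.partner (Sum.inl a) = Sum.inr b
  · have hba := N.partner_eq_comm.1 hab
    simp [wt, vote, hab, hba, G.prefers_irrefl]
  · have hba : N.partner (Sum.inr b) ≠ Sum.inl a := fun h => hab (N.partner_eq_comm.1 h)
    have hadj : G.Adj (Sum.inl a) (Sum.inr b) := h
    rcases N.vote_eq_one_or (Or.inr hadj) hab with ⟨h1, h2⟩ | ⟨h1, h2⟩ <;>
    rcases N.vote_eq_one_or (Or.inr (G.adj_symm hadj)) hba with ⟨h3, h4⟩ | ⟨h3, h4⟩ <;>
    simp [wt, h1, h2, h3, h4, h1.asymm, h3.asymm]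

theorem Matching.wtLoop_eq_vote (N : G.Matching) (u : A ⊕ B) : N.wtLoop u = N.vote u u := by
  by_cases h : N.partner u = u
  · simp [wtLoop, vote, h, G.not_prefers_self]
  · rw [N.vote_eq_neg_one ⟨(N.adj_or_self u).resolve_left h, Or.inl rfl⟩]
    simp [wtLoop, h]

theorem Matching.sum_vote [Fintype A] [Fintype B] (M N : G.Matching) :
    ∑ u, N.vote u (M.partner u) = (M.votes N : ℤ) - N.votes M := by
  classical
  simp only [vote, Finset.sum_sub_distrib, Finset.sum_boole, votes]
  rw [Set.ncard_eq_toFinset_card', Set.ncard_eq_toFinset_card']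
  simp

theorem PopularEdge.symm {u v : A ⊕ B} (h : G.PopularEdge u v) : G.PopularEdge v u := by
  obtain ⟨M, hM, rfl⟩ := h
  exact ⟨M, hM, M.invol u⟩

end Votes

/-! ### Witnesses as dual solutions. -/

section Witness

variable {A B : Type*} [Fintype A] [Fintype B] {G : MarriageInstance A B}
  {N : G.Matching} {α : A ⊕ B → ℤ}

theorem Matching.IsWitness.vote_add_vote_le (hα : N.IsWitness α) {u v : A ⊕ B}
    (h : G.Adj u v) : N.vote u v + N.vote v u ≤ α u + α v := by
  rcases u with u | u <;> rcases v with v | v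
  · exact h.elim
  · rw [← N.wt_eq_vote_add_vote h]
    exact hα.2.2.1 _ _ h
  · rw [add_comm (α _), add_comm, ← N.wt_eq_vote_add_vote h]
    exact hα.2.2.1 _ _ h
  · exact h.elim

theorem Matching.sum_add_partner (M : G.Matching) (f : A ⊕ B → ℤ) :
    ∑ u, (f u + f (M.partner u)) = 2 * ∑ u, f u := by
  have := Equiv.sum_comp (Function.Involutive.toPerm M.partner M.invol) f
  rw [Finset.sum_add_distrib, two_mul]
  exact congrArg _ this

/-- The edges of a matching that does not lose against `N` are tight for every witness of `N`. -/
theorem Matching.IsWitness.tight (hα : N.IsWitness α) {M : G.Matching}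
    (hM : N.votes M ≤ M.votes N) (u : A ⊕ B) :
    N.vote u (M.partner u) + N.vote (M.partner u) u = α u + α (M.partner u) := by
  have hle : ∀ u, N.vote u (M.partner u) + N.vote (M.partner u) (M.partner (M.partner u)) ≤
      α u + α (M.partner u) := by
    intro u
    rw [M.invol]
    rcases M.adj_or_self u with h | h
    · rw [h]
      have := hα.2.2.2 u
      rw [N.wtLoop_eq_vote] at this
      omega
    · exact hα.vote_add_vote_le h
  have h1 := M.sum_add_partner fun u => N.vote u (M.partner u)
  have h2 := M.sum_add_partner α
  rw [hα.2.1] at h2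
  rw [M.sum_vote N] at h1
  -- The left sum is twice the vote margin of `M` over `N`, hence nonnegative, and the right sum is
  -- twice the sum of `α`, hence zero. So all the termwise inequalities are equalities.
  have h3 : ∑ u, (N.vote u (M.partner u) + N.vote (M.partner u) (M.partner (M.partner u))) =
      ∑ u, (α u + α (M.partner u)) := by
    refine le_antisymm (Finset.sum_le_sum fun u _ => hle u) ?_
    rw [h1, h2]
    omega
  have := (Finset.sum_eq_sum_iff_of_le fun u _ => hle u).1 h3 u (Finset.mem_univ u)
  rwa [M.invol] at this

theorem Matching.IsWitness.add_partner (hα : N.IsWitness α) (u : A ⊕ B) :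
    α u + α (N.partner u) = 0 := by
  rw [← hα.tight le_rfl u, N.vote_partner, zero_add]
  have := N.vote_partner (N.partner u)
  rwa [N.invol] at this

/-- Off `N`, both endpoints of an edge cast a vote of ±1, so the sum of the votes is even. By
tightness `α` has the same parity at both ends, and 0 is the only even value allowed. -/
theorem Matching.IsWitness.eq_zero_of_popularEdge (hα : N.IsWitness α) {u v : A ⊕ B}
    (h : G.PopularEdge u v) (hu : α u = 0) : α v = 0 := by
  obtain ⟨M, hM, rfl⟩ := h
  have ht := hα.tight (hM N) u
  have hr := hα.1 (M.partner u)
  rcases M.adj_or_self u with h | h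
  · rw [h, hu]
  · by_cases hN : N.partner u = M.partner u
    · have := hα.add_partner u
      rw [hN] at this
      omega
    · have hN' : N.partner (M.partner u) ≠ u := fun h => hN (N.partner_eq_comm.1 h)
      rcases N.vote_eq_one_or (Or.inr h) hN with ⟨-, h1⟩ | ⟨-, h1⟩ <;>
      rcases N.vote_eq_one_or (Or.inr (G.adj_symm h)) hN' with ⟨-, h2⟩ | ⟨-, h2⟩ <;>
      omega

/-- A witness that vanishes at a vertex vanishes on its component in the popular subgraph. -/
theorem Matching.IsWitness.eq_zero_of_mem_component (hα : N.IsWitness α) {u v : A ⊕ B}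
    (hv : α v = 0) (h : u ∈ G.component v) : α u = 0 := by
  obtain ⟨p⟩ := (h : G.popularSubgraph.Reachable v u)
  induction p with
  | nil => exact hv
  | cons h _ ih =>
    refine ih (hα.eq_zero_of_popularEdge ?_ hv)
    exact h.2.elim id PopularEdge.symm

/-- Partners have opposite values, so the superscript at `u_ℓ` is determined by `α u` alone. This
replaces the case distinction in the definition. -/
theorem Matching.IsWitness.mem_realization (hα : N.IsWitness α) {e : HEdge (A ⊕ B)} :
    e ∈ N.realization α ↔ ∃ u, e = ⟨u, N.partner u, decide (α u = 1)⟩ := by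
  constructor
  · rintro (⟨a, b, hab, h⟩ | ⟨u, hu, rfl⟩)
    · have hba := N.partner_eq_comm.1 hab
      rcases h with ⟨h1, h2, rfl | rfl⟩ | ⟨h1, h2, rfl | rfl⟩ | ⟨h1, h2, rfl | rfl⟩
      · exact ⟨Sum.inl a, by simp [hab, h1]⟩
      · exact ⟨Sum.inr b, by simp [hba, h2]⟩
      · exact ⟨Sum.inl a, by simp [hab, h1]⟩
      · exact ⟨Sum.inr b, by simp [hba, h2]⟩
      · exact ⟨Sum.inl a, by simp [hab, h1]⟩
      · exact ⟨Sum.inr b, by simp [hba, h2]⟩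
    · have h0 : α u = 0 := by
        have := hα.add_partner u
        rw [hu] at this
        omega
      exact ⟨u, by simp [hu, h0]⟩
  · rintro ⟨u, rfl⟩
    have h0 := hα.add_partner u
    rcases hN : N.partner u with a | b <;> rcases u with a' | b'
    · have : a = a' := by
        have := N.adj_or_self (Sum.inl a')
        rw [hN] at this
        exact this.elim (fun h => Sum.inl_injective h) False.elim
      subst this
      rw [hN] at h0
      exact Or.inr ⟨_, hN, by simp; omega⟩
    · rw [hN] at h0
      refine Or.inl ⟨a, b', N.partner_eq_comm.1 hN, ?_⟩
      rcases hα.1 (Sum.inr b') with h | h | h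
      · exact Or.inr (Or.inl ⟨by omega, h, by simp [h]⟩)
      · exact Or.inr (Or.inr ⟨by omega, h, by simp [h]⟩)
      · exact Or.inl ⟨by omega, h, by simp [h]⟩
    · rw [hN] at h0
      refine Or.inl ⟨a', b, hN, ?_⟩
      rcases hα.1 (Sum.inl a') with h | h | h
      · exact Or.inl ⟨h, by omega, by simp [h]⟩
      · exact Or.inr (Or.inr ⟨h, by omega, by simp [h]⟩)
      · exact Or.inr (Or.inl ⟨h, by omega, by simp [h]⟩)
    · have : b = b' := by
        have := N.adj_or_self (Sum.inr b')
        rw [hN] at this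
        exact this.elim (fun h => Sum.inr_injective h) False.elim
      subst this
      rw [hN] at h0
      exact Or.inr ⟨_, hN, by simp; omega⟩

/-- The superscripts that a blocking edge must beat bound `α u + α v` from above, and its
preferences bound the two votes from below. Each combination violates the covering inequality of the
edge. -/
theorem Matching.IsWitness.isHStable_realization (hα : N.IsWitness α) :
    G.IsHStable (N.realization α) := by
  have hmem : ∀ u, (⟨u, N.partner u, decide (α u = 1)⟩ : HEdge (A ⊕ B)) ∈ N.realization α :=
    fun u => hα.mem_realization.2 ⟨u, rfl⟩
  refine ⟨⟨?_, ?_, ?_⟩, ?_⟩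
  · intro e he
    obtain ⟨u, rfl⟩ := hα.mem_realization.1 he
    rcases N.adj_or_self u with h | h
    · refine Or.inr ⟨h.symm, ?_⟩
      have := hα.add_partner u
      rw [h] at this
      simp only [decide_eq_false_iff_not]
      omega
    · exact Or.inl h
  · intro e he f hf hef
    obtain ⟨u, rfl⟩ := hα.mem_realization.1 he
    obtain ⟨v, rfl⟩ := hα.mem_realization.1 hf
    obtain rfl : u = v := hef
    rfl
  · intro e he f hf hef
    obtain ⟨u, rfl⟩ := hα.mem_realization.1 he
    obtain ⟨v, rfl⟩ := hα.mem_realization.1 hf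
    obtain rfl : u = v := by
      rw [← N.invol u, ← N.invol v]
      exact congrArg _ hef
    rfl
  · rintro ⟨u, v, t⟩ ⟨he, hl, hr⟩
    have hl := (hl _ (hmem u) rfl).2
    have hr := (hr _ (hmem (N.partner v)) (N.invol v)).2
    dsimp only at hl hr
    have hv := hα.add_partner v
    rcases he with he | ⟨huv, hf⟩
    · have hadj := hα.vote_add_vote_le he
      have hu1 := N.neg_one_le_vote u v
      have hv1 := N.neg_one_le_vote v u
      have hur := hα.1 u
      have hvr := hα.1 v
      dsimp only at hu1 hv1 hadj
      cases t
      · simp only [Bool.false_eq_true, false_and, false_or, true_and] at hl hr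
        have := N.vote_eq_one hl.2
        have hu := of_decide_eq_false hl.1.symm
        rcases hr with hr | hr
        · have := of_decide_eq_true hr
          omega
        · have := N.vote_eq_one hr.2
          omega
      · simp only [Bool.true_eq_false, false_and, false_or, true_and] at hl hr
        have := N.vote_eq_one hr.2
        have := of_decide_eq_true hr.1.symm
        rcases hl with hl | hl
        · have := of_decide_eq_false hl
          omega
        · have := N.vote_eq_one hl.2
          have := of_decide_eq_true hl.1.symm
          omega
    · obtain rfl : u = v := huv
      rcases hl with hl | hl
      · exact absurd (hl.1.symm.trans hf) (by decide)
      · exact G.not_prefers_self _ _ hl.2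

end Witness

end MarriageInstance

/-! ### A-popular matchings use only valid edges. -/

namespace MarriageInstance

section APopular

variable {A B : Type*} {G : MarriageInstance A B}

open Classical in
/-- Match `u` to `v` and leave their former partners unmatched. -/
noncomputable def Matching.rematch (N : G.Matching) (u v : A ⊕ B) (h : G.Adj u v) :
    G.Matching where
  partner w := if w = u then v else if w = v then u else
    if N.partner w = u ∨ N.partner w = v then w else N.partner w
  invol w := by
    have hne : u ≠ v := fun h' => G.adj_irrefl _ (h' ▸ h)
    by_cases h1 : w = u
    · simp [h1, hne.symm]
    by_cases h2 : w = v
    · simp [h2, hne.symm]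
    by_cases h3 : N.partner w = u ∨ N.partner w = v
    · simp [h1, h2, h3]
    · simp only [not_or] at h3
      simp [h1, h2, h3, N.invol]
  adj_or_self w := by
    split_ifs with h1 h2 h3
    · exact Or.inr (h1 ▸ h)
    · exact Or.inr (h2 ▸ G.adj_symm h)
    · exact Or.inl rfl
    · exact N.adj_or_self w

theorem Matching.rematch_partner_left (N : G.Matching) {u v : A ⊕ B} (h : G.Adj u v) :
    (N.rematch u v h).partner u = v := if_pos rfl

theorem Matching.rematch_partner_of_ne (N : G.Matching) {u v w : A ⊕ B} (h : G.Adj u v)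
    (h1 : w ≠ u) (h2 : w ≠ v) (h3 : N.partner w ≠ u) (h4 : N.partner w ≠ v) :
    (N.rematch u v h).partner w = N.partner w := by
  simp [rematch, h1, h2, h3, h4]

theorem Matching.rematch_partner_agent (N : G.Matching) {a a' : A} {b : B}
    (h : G.Adj (Sum.inl a) (Sum.inr b)) (h1 : a' ≠ a)
    (h4 : N.partner (Sum.inl a') ≠ Sum.inr b) :
    (N.rematch _ _ h).partner (Sum.inl a') = N.partner (Sum.inl a') := by
  refine N.rematch_partner_of_ne h (fun h => h1 (Sum.inl_injective h)) Sum.inl_ne_inr ?_ h4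
  intro h'
  have := N.adj_or_self (Sum.inl a')
  rw [h'] at this
  exact this.elim (fun h => h1 (Sum.inl_injective h).symm) id

theorem Matching.APopular.ncard_le [Finite A] {N : G.Matching} (hN : N.APopular)
    (M : G.Matching) {W L : Set A}
    (hW : ∀ a ∈ W, G.Prefers (Sum.inl a) (M.partner (Sum.inl a)) (N.partner (Sum.inl a)))
    (hL : ∀ a, G.Prefers (Sum.inl a) (N.partner (Sum.inl a)) (M.partner (Sum.inl a)) → a ∈ L) :
    W.ncard ≤ L.ncard :=
  (Set.ncard_le_ncard hW).trans ((hN M).trans (Set.ncard_le_ncard hL))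

theorem exists_isFirst (a : A) (h : ∃ b, G.E a b) : ∃ b : B, G.IsFirst a (Sum.inr b) := by
  obtain ⟨b, hb, hmin⟩ := (measure (G.rankA a)).wf.has_min {b | G.E a b} h
  refine ⟨b, hb, fun y hy hyb => ?_⟩
  rcases y with y | y
  · exact hy
  · rcases hyb.2 with h | h
    · simp at h
    · exact hmin y hy h.2

theorem IsFirst.prefers {a : A} {x y : A ⊕ B} (h : G.IsFirst a x)
    (hy : y = Sum.inl a ∨ G.Adj (Sum.inl a) y) (hne : x ≠ y) : G.Prefers (Sum.inl a) x y := by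
  rcases G.prefers_total (Or.inr h.1) hy hne with h' | h'
  · exact h'
  · exact absurd h' (h.2 y h'.1)

/-- If `N` is `A`-popular and an agent prefers the job `b` to its partner, then `b` is the top
choice of its partner. -/
theorem Matching.APopular.isFirst_of_prefers [Finite A] {N : G.Matching} (hN : N.APopular)
    (hA : ∀ a : A, ∃ b : B, G.E a b) {a : A} {b : B}
    (h : G.Prefers (Sum.inl a) (Sum.inr b) (N.partner (Sum.inl a))) :
    ∃ a', N.partner (Sum.inr b) = Sum.inl a' ∧ G.IsFirst a' (Sum.inr b) := by
  by_contra hcon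
  push Not at hcon
  rcases hb : N.partner (Sum.inr b) with a₂ | b'
  · have ha₂ := N.partner_eq_comm.1 hb
    have hne : a ≠ a₂ := by
      rintro rfl
      rw [ha₂] at h
      exact G.prefers_irrefl _ _ h
    obtain ⟨b₂, hb₂⟩ := exists_isFirst a₂ (hA a₂)
    have hbb : b₂ ≠ b := by
      rintro rfl
      exact hcon a₂ hb hb₂
    -- Promote `a` to `b` and its displaced owner `a₂` to the top choice `b₂`: two agents gain, and
    -- only the former partner of `b₂` can lose.
    let M₁ := N.rematch _ _ h.1
    let M := M₁.rematch _ _ hb₂.1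
    have hM₁a : M₁.partner (Sum.inl a) = Sum.inr b := N.rematch_partner_left h.1
    have hMa : M.partner (Sum.inl a) = Sum.inr b := by
      refine (M₁.rematch_partner_agent hb₂.1 hne ?_).trans hM₁a
      rw [hM₁a]
      exact fun h => hbb (Sum.inr_injective h).symm
    have hMa₂ : M.partner (Sum.inl a₂) = Sum.inr b₂ := M₁.rematch_partner_left hb₂.1
    have hpref₂ : G.Prefers (Sum.inl a₂) (Sum.inr b₂) (Sum.inr b) := by
      refine hb₂.prefers ?_ (fun h => hbb (Sum.inr_injective h))
      have := N.adj_or_self (Sum.inl a₂)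
      rwa [ha₂] at this
    have := hN.ncard_le M (W := {a, a₂})
      (L := {a' | N.partner (Sum.inl a') = Sum.inr b₂}) (by
        rintro a' (rfl | rfl)
        · rwa [hMa]
        · rwa [hMa₂, ha₂]) (by
        intro a' ha'
        by_contra hL
        rcases eq_or_ne a' a with rfl | h1
        · rw [hMa] at ha'
          exact ha'.asymm h
        rcases eq_or_ne a' a₂ with rfl | h2
        · rw [hMa₂, ha₂] at ha'
          exact ha'.asymm hpref₂
        have h3 : M₁.partner (Sum.inl a') = N.partner (Sum.inl a') := by
          refine N.rematch_partner_agent h.1 h1 fun h' => h2 ?_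
          rw [N.partner_eq_comm, hb] at h'
          exact (Sum.inl_injective h').symm
        have h4 : M.partner (Sum.inl a') = N.partner (Sum.inl a') :=
          (M₁.rematch_partner_agent hb₂.1 h2 (by rwa [h3])).trans h3
        rw [h4] at ha'
        exact G.prefers_irrefl _ _ ha')
    rw [Set.ncard_pair hne] at this
    have hL : Set.ncard {a' | N.partner (Sum.inl a') = Sum.inr b₂} ≤ 1 := by
      rw [Set.ncard_le_one]
      intro x hx y hy
      rw [Set.mem_ofPred_eq, N.partner_eq_comm] at hx hy
      exact Sum.inl_injective (hx.symm.trans hy)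
    omega
  -- Here `b` is unmatched, so promoting `a` harms no agent.
  · have := hN.ncard_le (N.rematch _ _ h.1) (W := {a}) (L := ∅) (by
        rintro a' rfl
        rwa [N.rematch_partner_left]) (by
        intro a' ha'
        rcases eq_or_ne a' a with rfl | h1
        · rw [N.rematch_partner_left] at ha'
          exact ha'.asymm h
        rw [N.rematch_partner_agent h.1 h1 (fun h' => by
          rw [N.partner_eq_comm, hb] at h'
          simp at h')] at ha'
        exact G.prefers_irrefl _ _ ha')
    simp at this

theorem Matching.APopular.isFirst_partner [Finite A] {N : G.Matching} (hN : N.APopular)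
    (hA : ∀ a : A, ∃ b : B, G.E a b) {a : A} {b : B} (h : G.IsFirst a (Sum.inr b)) :
    ∃ a', N.partner (Sum.inr b) = Sum.inl a' ∧ G.IsFirst a' (Sum.inr b) := by
  by_cases hab : N.partner (Sum.inl a) = Sum.inr b
  · exact ⟨a, N.partner_eq_comm.1 hab, h⟩
  · exact hN.isFirst_of_prefers hA (h.prefers (N.adj_or_self _) (Ne.symm hab))

/-- A top choice job always goes to an agent who ranks it first, and every job that an agent prefers
to its partner is somebody's top choice. -/
theorem Matching.APopular.isFirst_or_isSecond [Finite A] {N : G.Matching} (hN : N.APopular)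
    (hA : ∀ a : A, ∃ b : B, G.E a b) (a : A) :
    G.IsFirst a (N.partner (Sum.inl a)) ∨ G.IsSecond a (N.partner (Sum.inl a)) := by
  refine or_iff_not_imp_left.2 fun h => ⟨N.adj_or_self _, fun a' ha' => h ?_, ?_⟩
  · rcases hx : N.partner (Sum.inl a) with x | b
    · rw [hx] at ha'
      exact ha'.1.elim
    · rw [hx] at ha'
      obtain ⟨a'', h1, h2⟩ := hN.isFirst_partner hA ha'
      rw [N.partner_eq_comm.1 hx] at h1
      rwa [Sum.inl_injective h1]
  · intro y _ hy hpref
    rcases y with y | b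
    · exact hpref.1
    · obtain ⟨a', -, ha'⟩ := hN.isFirst_of_prefers hA hpref
      exact hy a' ha'

/-- The edges and self-loops of an `A`-popular matching are valid. -/
theorem Matching.APopular.validEdge [Finite A] {N : G.Matching} (hN : N.APopular)
    (hA : ∀ a : A, ∃ b : B, G.E a b) (u : A ⊕ B) : G.ValidEdge u (N.partner u) := by
  rcases u with a | b
  · exact Or.inl ⟨a, rfl, hN.isFirst_or_isSecond hA a⟩
  · rcases hx : N.partner (Sum.inr b) with a | b'
    · have := hN.isFirst_or_isSecond hA a
      rw [N.partner_eq_comm.1 hx] at this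
      exact Or.inr (Or.inl ⟨a, rfl, this⟩)
    · have hb := N.adj_or_self (Sum.inr b)
      rw [hx] at hb
      refine Or.inr (Or.inr ⟨b, rfl, hb.elim id False.elim, fun a ha => ?_⟩)
      obtain ⟨a', h, -⟩ := hN.isFirst_partner hA ha
      rw [hx] at h
      simp at h

end APopular

end MarriageInstance

/-! ### Integral duality for weighted bipartite matching. -/

/-- Egerváry's theorem: the maximum weight of a perfect matching is the minimum of an integral
cover. -/
theorem exists_perm_sum_eq_cover {V : Type*} [Fintype V] (r : V → V → Prop) (hr : ∀ u, r u u)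
    (W : V → V → ℤ) : ∃ (σ : Equiv.Perm V) (y z : V → ℤ), (∀ u, r u (σ u)) ∧
      (∀ u v, r u v → W u v ≤ y u + z v) ∧ ∑ u, (y u + z u) = ∑ u, W u (σ u) := by
  classical
  let D : Set ((V → ℤ) × (V → ℤ)) := {p | ∀ u v, r u v → W u v ≤ p.1 u + p.2 v}
  -- The identity is an admissible permutation, so its weight bounds every cover from below. On `D`
  -- the truncation by `toNat` therefore loses nothing, and a cheapest cover exists.
  let f : (V → ℤ) × (V → ℤ) → ℕ := fun p => (∑ u, (p.1 u + p.2 u) - ∑ u, W u u).toNat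
  have hne : D.Nonempty := by
    refine ⟨⟨fun u => ∑ v, |W u v|, 0⟩, fun u v _ => ?_⟩
    simp only [Pi.zero_apply, add_zero]
    exact (le_abs_self _).trans
      (Finset.single_le_sum (f := fun v => |W u v|) (fun _ _ => abs_nonneg _) (Finset.mem_univ v))
  obtain ⟨⟨y, z⟩, hyz, hmin⟩ := (measure f).wf.has_min D hne
  have hlow : ∀ p ∈ D, ∑ u, W u u ≤ ∑ u, (p.1 u + p.2 u) := fun p hp =>
    Finset.sum_le_sum fun u _ => hp u u (hr u)
  let t : V → Finset V := fun u => {v | r u v ∧ W u v = y u + z v}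
  have hall : ∀ S : Finset V, S.card ≤ (S.biUnion t).card := by
    intro S
    by_contra! hS
    -- If Hall's condition fails at `S` for the tight edges, lowering `y` on `S` and raising `z` on
    -- its tight neighbours gives a cheaper cover. Integrality ensures that the non-tight edges have
    -- slack at least 1.
    let p : (V → ℤ) × (V → ℤ) := ⟨fun u => y u - if u ∈ S then 1 else 0,
      fun v => z v + if v ∈ S.biUnion t then 1 else 0⟩
    have hp : p ∈ D := by
      intro u v huv
      have h := hyz u v huv
      by_cases hu : u ∈ S
      · by_cases hv : v ∈ S.biUnion t
        · simp only [p, if_pos hu, if_pos hv]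
          dsimp only at h
          omega
        · have hne : W u v ≠ y u + z v := fun h' =>
            hv (Finset.mem_biUnion.2 ⟨u, hu, by simp [t, huv, h']⟩)
          simp only [p, if_pos hu, if_neg hv]
          dsimp only at h
          omega
      · simp only [p, if_neg hu]
        dsimp only at h
        split_ifs <;> omega
    have hsum : ∑ u, (p.1 u + p.2 u) = ∑ u, (y u + z u) - S.card + (S.biUnion t).card := by
      simp only [p, Finset.sum_add_distrib, Finset.sum_sub_distrib, Finset.sum_ite_mem,
        Finset.univ_inter, Finset.sum_const, nsmul_eq_mul, mul_one]
      ring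
    have h1 := hlow p hp
    refine hmin p hp ?_
    change (∑ u, (p.1 u + p.2 u) - ∑ u, W u u).toNat < (∑ u, (y u + z u) - ∑ u, W u u).toNat
    omega
  obtain ⟨g, hg, hgt⟩ := (Finset.all_card_le_biUnion_card_iff_exists_injective t).1 hall
  have hgt : ∀ u, r u (g u) ∧ W u (g u) = y u + z (g u) := fun u => by
    have := hgt u
    simpa [t] using this
  let σ : Equiv.Perm V := Equiv.ofBijective g (Finite.injective_iff_bijective.1 hg)
  refine ⟨σ, y, z, fun u => (hgt u).1, hyz, ?_⟩
  rw [Finset.sum_add_distrib, ← Equiv.sum_comp σ z, ← Finset.sum_add_distrib]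
  exact Finset.sum_congr rfl fun u _ => (hgt u).2.symm

/-! ### Popular matchings have witnesses. -/

namespace MarriageInstance

section Existence

variable {A B : Type*} {G : MarriageInstance A B}

/-- A permutation of the vertices along edges and self-loops yields a matching by keeping the images
of the agents. -/
def matchingOfPerm (σ : Equiv.Perm (A ⊕ B)) (hσ : ∀ u, u = σ u ∨ G.Adj u (σ u)) :
    G.Matching where
  partner
    | Sum.inl a => σ (Sum.inl a)
    | Sum.inr b => σ.symm (Sum.inr b)
  invol u := by
    rcases u with a | b
    · rcases h : σ (Sum.inl a) with a' | b
      · have := hσ (Sum.inl a)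
        rw [h] at this
        obtain rfl : a = a' := this.elim (fun h => Sum.inl_injective h) False.elim
        simp [h]
      · simp only [h]
        rw [← h, Equiv.symm_apply_apply]
    · rcases h : σ.symm (Sum.inr b) with a | b'
      · simp only [h]
        rw [← h, Equiv.apply_symm_apply]
      · have := hσ (Sum.inr b')
        rw [← h, Equiv.apply_symm_apply, h] at this
        obtain rfl : b' = b := this.elim (fun h => Sum.inr_injective h) False.elim
        simp [h]
  adj_or_self u := by
    rcases u with a | b
    · exact (hσ (Sum.inl a)).imp Eq.symm id
    · have := hσ (σ.symm (Sum.inr b))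
      rw [Equiv.apply_symm_apply] at this
      exact this.imp id G.adj_symm

/-- Every popular matching has a witness. -/
theorem Matching.Popular.exists_isWitness [Fintype A] [Fintype B] {N : G.Matching}
    (hN : N.Popular) : ∃ α, N.IsWitness α := by
  -- Only agents as sources and jobs as targets vote. Pairs (agent, job) thus carry the weight `wt`,
  -- self-loops carry `wtLoop`, and reversed pairs (job, agent) carry 0. The latter absorb the spare
  -- copies of matched vertices.
  let p : A ⊕ B → A ⊕ B → ℤ := fun u v => Sum.elim (fun a => N.vote (Sum.inl a) v) 0 u
  let q : A ⊕ B → A ⊕ B → ℤ := fun u v => Sum.elim 0 (fun b => N.vote (Sum.inr b) u) v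
  obtain ⟨σ, y, z, hσ, hyz, hsum⟩ := exists_perm_sum_eq_cover
    (fun u v => u = v ∨ G.Adj u v) (fun u => Or.inl rfl) (fun u v => p u v + q u v)
  let M := matchingOfPerm σ hσ
  have hM : ∑ u, (p u (σ u) + q u (σ u)) = ∑ u, N.vote u (M.partner u) := by
    have hq : ∑ u, q u (σ u) = ∑ v, q (σ.symm v) v := by
      rw [← Equiv.sum_comp σ fun v => q (σ.symm v) v]
      exact Finset.sum_congr rfl fun u _ => by rw [Equiv.symm_apply_apply]
    rw [Finset.sum_add_distrib, hq]
    simp [Fintype.sum_sum_type, p, q, M, matchingOfPerm]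
  have hle : ∑ u, (y u + z u) ≤ 0 := by
    rw [hsum, hM, M.sum_vote N]
    have := hN M
    omega
  -- Adding the constraints of the pair and of the reversed pair merges the two duals into the
  -- candidate `y + z`.
  have hadj : ∀ a b, G.E a b → N.wt a b ≤
      (y (Sum.inl a) + z (Sum.inl a)) + (y (Sum.inr b) + z (Sum.inr b)) := by
    intro a b hab
    have h1 := hyz (Sum.inl a) (Sum.inr b) (Or.inr hab)
    have h2 := hyz (Sum.inr b) (Sum.inl a) (Or.inr hab)
    simp only [p, q, Sum.elim_inl, Sum.elim_inr, Pi.zero_apply] at h1 h2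
    rw [N.wt_eq_vote_add_vote hab]
    omega
  have hloop : ∀ u, N.wtLoop u ≤ y u + z u := by
    intro u
    rw [N.wtLoop_eq_vote]
    have := hyz u u (Or.inl rfl)
    rcases u with a | b <;>
    simpa [p, q] using this
  have hpair : ∀ u, 0 ≤ (y u + z u) + (y (N.partner u) + z (N.partner u)) := by
    have key : ∀ (a : A) (b : B), N.partner (Sum.inl a) = Sum.inr b → N.wt a b = 0 := by
      intro a b h
      have hE := N.adj_or_self (Sum.inl a)
      rw [h] at hE
      rw [N.wt_eq_vote_add_vote (hE.resolve_left Sum.inr_ne_inl), ← h, N.vote_partner, h,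
        ← N.partner_eq_comm.1 h, N.vote_partner]
      rfl
    intro u
    rcases N.adj_or_self u with h | h
    · have := hloop u
      simp only [wtLoop, h, if_true] at this
      rw [h]
      omega
    · rcases u with a | b <;> rcases hx : N.partner _ with a' | b' <;> rw [hx] at h
      · exact h.elim
      · have := hadj a b' h
        rwa [key a b' hx] at this
      · have := hadj a' b h
        rwa [key a' b (N.partner_eq_comm.1 hx), add_comm] at this
      · exact h.elim
  have hsum2 := N.sum_add_partner fun u => y u + z u
  have hzero : ∀ u, (y u + z u) + (y (N.partner u) + z (N.partner u)) = 0 := by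
    have h0 : ∑ u, ((y u + z u) + (y (N.partner u) + z (N.partner u))) = 0 :=
      le_antisymm (by rw [hsum2]; omega) (Finset.sum_nonneg fun u _ => hpair u)
    intro u
    exact (Finset.sum_eq_zero_iff_of_nonneg fun u _ => hpair u).1 h0 u (Finset.mem_univ u)
  -- Self-loops bound the values below by -1. As partners have opposite values, they are also at
  -- most 1.
  have hlow : ∀ u, -1 ≤ y u + z u := fun u => by
    refine le_trans ?_ (hloop u)
    unfold wtLoop
    split_ifs <;> norm_num
  refine ⟨fun u => y u + z u, fun u => ?_, ?_, hadj, hloop⟩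
  · have h1 := hlow u
    have h2 := hlow (N.partner u)
    have h3 := hzero u
    dsimp only
    omega
  · have : ∑ u, ((y u + z u) + (y (N.partner u) + z (N.partner u))) = 0 :=
      Finset.sum_eq_zero fun u _ => hzero u
    dsimp only
    omega

end Existence

/-! ### Realizations survive every iteration. -/

section Main

variable {A B : Type*} [Fintype A] [Fintype B] {G : MarriageInstance A B}

theorem Matching.FullyPopular.isHLegal_realization {N : G.Matching} (hN : N.FullyPopular)
    (hA : ∀ a : A, ∃ b : B, G.E a b) {α : A ⊕ B → ℤ} (hα : N.IsWitness α) :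
    G.IsHLegal (N.realization α) := by
  intro e he h
  obtain ⟨u, rfl⟩ := hα.mem_realization.1 he
  exact h.2 ⟨hN.2.validEdge hA u, N, hN.1, rfl⟩

/-- In the left-optimal matching of an iteration, a vertex whose left copy and right copy are both
matched by `-`/`+` edges has value `0` in every witness realized in that iteration. -/
theorem Reaches.witness_eq_zero {i : ℕ} {s : AlgState A B} (h : G.Reaches i s)
    {N : G.Matching} {α : A ⊕ B → ℤ} (hα : N.IsWitness α) (hD : N.realization α ∈ s.D G)
    {u x y : A ⊕ B} (hl : (⟨u, x, false⟩ : HEdge (A ⊕ B)) ∈ s.S G)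
    (hr : (⟨y, u, false⟩ : HEdge (A ⊕ B)) ∈ s.S G) : α u = 0 := by
  have h1 : α u ≠ 1 := by
    intro h1
    rcases h.left_optimal hD hl (hα.mem_realization.2 ⟨u, rfl⟩) rfl with h' | h'
    · simp [h1] at h'
    · simpa [h1] using h'.2
  -- Otherwise the realization would match `u_r` to a `+` neighbour, a choice worse than its edge in
  -- the right-pessimal matching.
  have h2 : α (N.partner u) ≠ 1 := by
    intro h2
    refine h.right_pessimal hD hr (hα.mem_realization.2 ⟨N.partner u, rfl⟩)
      ⟨(N.invol u).symm, Or.inl ⟨rfl, ?_⟩⟩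
    simp [h2]
  have h3 := hα.add_partner u
  have h4 := hα.1 u
  omega

theorem Reaches.witness_eq_zero_of_mem_candidates {i : ℕ} {s : AlgState A B}
    (h : G.Reaches i s) {N : G.Matching} {α : A ⊕ B → ℤ} (hα : N.IsWitness α)
    (hD : N.realization α ∈ s.D G) {u : A ⊕ B} (hu : u ∈ candidates (s.S G)) : α u = 0 := by
  rcases hu with ⟨a, ⟨⟨b, hb⟩, ⟨d, hd⟩⟩, rfl⟩ | ⟨b, ⟨⟨a, ha⟩, ⟨c, hc⟩⟩, rfl⟩
  · exact h.witness_eq_zero hα hD hb hd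
  · exact h.witness_eq_zero hα hD hc ha

theorem Reaches.realization_mem_D {i : ℕ} {s : AlgState A B} (h : G.Reaches i s)
    (hA : ∀ a : A, ∃ b : B, G.E a b) {N : G.Matching} {α : A ⊕ B → ℤ} (hN : N.FullyPopular)
    (hα : N.IsWitness α) : N.realization α ∈ s.D G := by
  refine ⟨hα.isHStable_realization, hN.isHLegal_realization hA hα, ?_⟩
  induction h with
  | start R hR => exact fun _ _ => id
  | iterate i s v R hs hperfect hv hmark hR ih =>
    rintro e he (h | ⟨-, ht, a, ha, h⟩)
    · exact ih e he h
    -- The induction hypothesis places the realization in the previous D_i, so the chosen candidate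
    -- has value 0. The value spreads over its component, where agents and their partners then only
    -- carry `leftPlus = false` edges.
    · have h0 : α v = 0 := hs.witness_eq_zero_of_mem_candidates hα
        ⟨hα.isHStable_realization, hN.isHLegal_realization hA hα, ih⟩ hv
      have ha0 := hα.eq_zero_of_mem_component h0 ha
      obtain ⟨u, rfl⟩ := hα.mem_realization.1 he
      have hu := of_decide_eq_true ht
      have hu' := hα.add_partner u
      rcases h with h | h <;> dsimp only at h <;> rw [h] at hu'
      · rw [h] at hu
        omega
      · omega

end Main

end MarriageInstance

theorem mainTheorem4 {A B : Type*} [Fintype A] [Fintype B] (G : MarriageInstance A B)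
    (hA : ∀ a : A, ∃ b : B, G.E a b) :
    (∀ (i : ℕ) (s : MarriageInstance.AlgState A B), G.Reaches i s →
      -- the set `D_i` is a sublattice of the lattice of stable matchings
      G.IsStableSublattice (s.D G) ∧
      -- every realization of a fully popular matching is in `D_i`
      (∀ (N : G.Matching) (α : A ⊕ B → ℤ), N.FullyPopular → N.IsWitness α →
        N.realization α ∈ s.D G) ∧
      -- if all vertices are matched, `S_i` is the left-optimal element of `D_i`
      (MarriageInstance.IsHPerfect (s.S G) → s.S G ∈ s.D G ∧
        ∀ M ∈ s.D G, ∀ e ∈ s.S G, ∀ f ∈ M, e.left = f.left → e = f ∨ G.LeftPrefers e f) ∧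
      -- the candidates of `S_i` have witness value `0`
      (MarriageInstance.IsHPerfect (s.S G) →
        ∀ (N : G.Matching) (α : A ⊕ B → ℤ), N.FullyPopular → N.IsWitness α →
          (∀ a ∈ MarriageInstance.candidateAgents (s.S G), α (Sum.inl a) = 0) ∧
          (∀ b ∈ MarriageInstance.candidateJobs (s.S G), α (Sum.inr b) = 0)) ∧
      -- the Gale-Shapley computation fails exactly if `D_i` is empty
      (¬ MarriageInstance.IsHPerfect (s.S G) ↔ s.D G = ∅)) ∧
    -- the answer "no fully popular matching" is correct
    (G.ReportsNone → ¬ ∃ N : G.Matching, N.FullyPopular) := by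
  refine ⟨fun i s h => ⟨MarriageInstance.isStableSublattice_legalStable _,
    fun N α hN hα => h.realization_mem_D hA hN hα,
    fun hp => ⟨h.mem_D hp, fun M hM e he f hf hef => h.left_optimal hM he hf hef⟩,
    fun _ N α hN hα => ?_, h.not_isHPerfect_iff⟩, ?_⟩
  · have hD := h.realization_mem_D hA hN hα
    exact ⟨fun a ha => h.witness_eq_zero_of_mem_candidates hα hD (Or.inl ⟨a, ha, rfl⟩),
      fun b hb => h.witness_eq_zero_of_mem_candidates hα hD (Or.inr ⟨b, hb, rfl⟩)⟩
  · rintro ⟨i, s, h, hp⟩ ⟨N, hN⟩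
    obtain ⟨α, hα⟩ := hN.1.exists_isWitness
    exact Set.eq_empty_iff_forall_notMem.1 (h.not_isHPerfect_iff.1 hp) _
      (h.realization_mem_D hA hN hα)
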